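/- Let $h:\mathbb{R}\to[0,\infty)$ be twice continuously differentiable and $1$-periodic with $\int_0^1 h(x)\,dx=1$, and let $\theta_1,\theta_2,\dots$ be i.i.d. random variables on $[0,1]$ with density $h$. For $c>0$ define $\gamma_c:\mathbb{R}\to\mathbb{R}$ by $$\gamma_c(x)=\frac{\operatorname{sign}(x)}{\pi}\tan^{-1}\!\Big(\sqrt{e^{c}\tan^2(\pi x)+e^{c}-1}\Big)\quad(-\tfrac12<x\le\tfrac12,\ \gamma_c(\tfrac12)=\tfrac12),\qquad \gamma_c(k+x)=k+\gamma_c(x)\quad(k\in\mathbb{Z}),$$ (the boundary action, in the coordinate $e^{2\pi i x}$, of the inverse of the conformal map attaching a radial slit of capacity $c$ to the unit disk at $1$), and define the harmonic measure flow of the anisotropic Hastings–Levitov model by $X_0(x)=x$, $X_n(x)=\gamma_c(X_{n-1}(x)-\theta_n)+\theta_n$. Write $n(t)=\lfloor t/c\rfloor$. Let $$b(x)=\frac1{2\pi}\int_0^1\cot(\pi z)\,\big(h(x-z)-h(x)\big)\,dz,$$ and let $\psi_t(x)$, $t\ge 0$, be the solution of $\dot\psi_t(x)=b(\psi_t(x))$,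 $\psi_0(x)=x$. Let $a_u$ be an unstable fixed point: $b(a_u)=0$ and $b'(a_u)=\lambda_u>0$. **Theorem.** Let $T\ge 0$ be fixed. Then for every $\varepsilon>0$, with $k_0=n(t_0)$, $$\lim_{t_0\to\infty}\ \limsup_{c\downarrow 0}\ \mathbb{P}\left(\sup_{t_0\le t\le \frac1{4\lambda_u}\log(1/c)+T}\big|X_{n(t)}(a_u)-\psi_{t-t_0}\big(X_{k_0}(a_u)\big)\big|>\varepsilon\right)=0 .$$ -/

import Mathlib

open MeasureTheory ProbabilityTheory Filter Topology

namespace AHL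

/-- The boundary map of the inverse slit map of capacity `c`, in the angular coordinate `x`
(standing for `exp (2 π i x)`), on the fundamental domain `(-1/2, 1/2]`:
`sign x / π * arctan (√(e ^ c tan² (π x) + e ^ c - 1))`. At `x = 1/2` the tangent is infinite and
the value is the fixed point `1/2`. -/
noncomputable def gammaBase (c x : ℝ) : ℝ :=
  if x = 1 / 2 then 1 / 2
  else Real.sign x / Real.pi *
    Real.arctan (Real.sqrt (Real.exp c * Real.tan (Real.pi * x) ^ 2 + Real.exp c - 1))

/-- The lift of the boundary map to `ℝ`: for `x = k + a` with `k` an integer and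
`a ∈ (-1/2, 1/2]` (so `k = ⌈x - 1/2⌉`), its value is `k + gammaBase c a`. -/
noncomputable def gamma (c x : ℝ) : ℝ :=
  (⌈x - 1 / 2⌉ : ℝ) + gammaBase c (x - (⌈x - 1 / 2⌉ : ℝ))

/-- The harmonic measure flow `X_n(x)` with particle capacity `c` and attachment angles
`θ 1, θ 2, …` (the entry `θ 0` is not used):
`X_0(x) = x` and `X_n(x) = gamma (X_{n-1}(x) - θ_n) + θ_n`. -/
noncomputable def X (c : ℝ) (θ : ℕ → ℝ) (x : ℝ) : ℕ → ℝ
  | 0 => x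
  | n + 1 => gamma c (X c θ x n - θ (n + 1)) + θ (n + 1)

/-- The number `n(t) = ⌊t / c⌋` of particles attached by time `t`. -/
noncomputable def numParticles (c t : ℝ) : ℕ := ⌊t / c⌋₊

/-- The drift: the Hilbert transform of the density `h`,
`b(x) = (1 / 2π) ∫_0^1 cot (π z) (h (x - z) - h x) dz`. -/
noncomputable def drift (h : ℝ → ℝ) (x : ℝ) : ℝ :=
  1 / (2 * Real.pi) * ∫ z in (0 : ℝ)..1, Real.cot (Real.pi * z) * (h (x - z) - h x)

/-- `y` solves `y' = b(y)` on `[0, ∞)` with `y(0) = x`. -/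
def IsODESolution (b : ℝ → ℝ) (x : ℝ) (y : ℝ → ℝ) : Prop :=
  y 0 = x ∧ ∀ t : ℝ, 0 ≤ t → HasDerivWithinAt y (b (y t)) (Set.Ici 0) t

/-- The solution `ψ_t(x)` at time `t ≥ 0` of `y' = b(y)`, `y(0) = x`. (For bounded Lipschitz `b`, in
particular for the drift of a `C²` periodic density, the solution exists and is unique on
`[0, ∞)`.) -/
noncomputable def psi (b : ℝ → ℝ) (t x : ℝ) : ℝ :=
  Classical.epsilon (IsODESolution b x) t

/-- `h` is a twice continuously differentiable probability density on the circle `ℝ / ℤ`, given as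
a `1`-periodic function on `ℝ`. -/
structure IsSmoothDensity (h : ℝ → ℝ) : Prop where
  contDiff : ContDiff ℝ 2 h
  periodic : Function.Periodic h 1
  nonneg : ∀ x, 0 ≤ h x
  integral_eq_one : ∫ x in (0 : ℝ)..1, h x = 1

/-- The law of an attachment angle: the measure `h(x) dx` on `[0, 1]`. -/
noncomputable def angleLaw (h : ℝ → ℝ) : Measure ℝ :=
  (volume.restrict (Set.Icc 0 1)).withDensity fun x => ENNReal.ofReal (h x)

end AHL

namespace AHL

/-- The displacement of a point of the circle under the boundary map. -/
noncomputable def disp (c z : ℝ) : ℝ := gamma c z - z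

theorem disp_periodic (c : ℝ) : Function.Periodic (disp c) 1 := by
  intro z
  have h1 : ⌈z + 1 - 1 / 2⌉ = ⌈z - 1 / 2⌉ + 1 := by
    rw [← Int.ceil_add_one]; congr 1; ring
  simp only [disp, gamma, h1]
  push_cast
  rw [show z + 1 - ((⌈z - 1 / 2⌉ : ℝ) + 1) = z - ⌈z - 1 / 2⌉ by ring]
  ring

theorem disp_of_mem {c z : ℝ} (h1 : -(1 / 2) < z) (h2 : z ≤ 1 / 2) :
    disp c z = gammaBase c z - z := by
  have : ⌈z - 1 / 2⌉ = 0 := by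
    rw [Int.ceil_eq_iff]; push_cast; constructor <;> linarith
  simp only [disp, gamma, this, Int.cast_zero, zero_add, sub_zero]

theorem disp_zero (c : ℝ) : disp c 0 = 0 := by
  rw [disp_of_mem (by norm_num) (by norm_num)]; simp [gammaBase]

theorem disp_half (c : ℝ) : disp c (1 / 2) = 0 := by
  rw [disp_of_mem (by norm_num) (by norm_num)]; simp [gammaBase]

theorem disp_neg {c z : ℝ} (h1 : 0 < z) (h2 : z < 1 / 2) : disp c (-z) = -disp c z := by
  rw [disp_of_mem (by linarith) (by linarith), disp_of_mem (by linarith) (by linarith)]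
  have e1 : ¬ (-z = 1 / 2) := by intro h; linarith
  have e2 : ¬ (z = 1 / 2) := by intro h; linarith
  rw [gammaBase, gammaBase, if_neg e1, if_neg e2, Real.sign_of_neg (by linarith),
    Real.sign_of_pos h1, mul_neg, Real.tan_neg, neg_sq]
  ring

theorem measurable_disp (c : ℝ) : Measurable (disp c) := by
  have h0 : Measurable Real.sign := by
    unfold Real.sign
    exact Measurable.ite measurableSet_Iio measurable_const
      (Measurable.ite measurableSet_Ioi measurable_const measurable_const)
  have ht : Measurable Real.tan := by
    have : Real.tan = fun x => Real.sin x / Real.cos x := funext Real.tan_eq_sin_div_cos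
    rw [this]; fun_prop
  have hb : Measurable (gammaBase c) := by
    unfold gammaBase
    refine Measurable.ite (measurableSet_singleton _) measurable_const ?_
    refine (h0.div_const _).mul (Real.measurable_arctan.comp (Measurable.sqrt ?_))
    exact ((((ht.comp (measurable_const.mul measurable_id)).pow_const 2).const_mul _).add_const
      _).sub_const _
  have hk : Measurable fun x : ℝ => ((⌈x - 1 / 2⌉ : ℤ) : ℝ) :=
    (measurable_from_top (f := fun k : ℤ => (k : ℝ))).comp
      (Int.measurable_ceil.comp (measurable_id.sub_const _))
  unfold disp gamma
  exact (hk.add (hb.comp (measurable_id.sub hk))).sub measurable_id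

/-- On `(0, 1/2)` the boundary map satisfies `cos (π γ(z)) = e^{-c/2} cos (π z)`. -/
theorem cos_gammaBase {c z : ℝ} (hc : 0 ≤ c) (h1 : 0 < z) (h2 : z < 1 / 2) :
    0 ≤ gammaBase c z ∧ gammaBase c z < 1 / 2 ∧
      Real.cos (Real.pi * gammaBase c z) = Real.exp (-c / 2) * Real.cos (Real.pi * z) := by
  have hpi := Real.pi_pos
  have hcos : 0 < Real.cos (Real.pi * z) :=
    Real.cos_pos_of_mem_Ioo ⟨by nlinarith, by nlinarith⟩
  have hec : 1 ≤ Real.exp c := Real.one_le_exp hc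
  set u := Real.exp c * Real.tan (Real.pi * z) ^ 2 + Real.exp c - 1 with hu
  have hu0 : 0 ≤ u := by
    have : 0 ≤ Real.exp c * Real.tan (Real.pi * z) ^ 2 := by positivity
    linarith
  have e : gammaBase c z = Real.arctan (Real.sqrt u) / Real.pi := by
    rw [gammaBase, if_neg h2.ne, Real.sign_of_pos h1]; ring
  have hA := Real.arctan_lt_pi_div_two (Real.sqrt u)
  have hB : 0 ≤ Real.arctan (Real.sqrt u) := Real.arctan_nonneg.2 (Real.sqrt_nonneg u)
  refine ⟨by rw [e]; positivity, ?_, ?_⟩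
  · rw [e, div_lt_iff₀ hpi]; linarith
  · rw [e, mul_div_cancel₀ _ hpi.ne', Real.cos_arctan, Real.sq_sqrt hu0]
    have h3 : 1 + u = (Real.exp (c / 2) / Real.cos (Real.pi * z)) ^ 2 := by
      have h4 : Real.exp c = Real.exp (c / 2) ^ 2 := by
        rw [← Real.exp_nat_mul]; congr 1; push_cast; ring
      rw [hu, Real.tan_eq_sin_div_cos, h4]
      have h5 := Real.sin_sq_add_cos_sq (Real.pi * z)
      field_simp
      linear_combination Real.exp (c / 2) ^ 2 * h5
    rw [h3, Real.sqrt_sq (by positivity), neg_div, Real.exp_neg]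
    field_simp

theorem one_sub_exp_neg_bounds {s : ℝ} (hs : 0 ≤ s) :
    0 ≤ 1 - Real.exp (-s) ∧ 1 - Real.exp (-s) ≤ s ∧ s - s ^ 2 / 2 ≤ 1 - Real.exp (-s) := by
  have h1 := Real.add_one_le_exp (-s)
  have h2 : Real.exp (-s) ≤ 1 := Real.exp_le_one_iff.2 (by linarith)
  refine ⟨by linarith, by linarith, ?_⟩
  have h3 := Real.quadratic_le_exp_of_nonneg hs
  have h4 : Real.exp (-s) * Real.exp s = 1 := by rw [← Real.exp_add]; simp
  have h5 : 0 < Real.exp (-s) := Real.exp_pos _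
  have h6 : 0 ≤ 1 - s + s ^ 2 / 2 := by nlinarith [sq_nonneg (s - 1)]
  have h7 : 1 ≤ (1 - s + s ^ 2 / 2) * (1 + s + s ^ 2 / 2) := by nlinarith [sq_nonneg (s ^ 2)]
  have h8 := mul_le_mul_of_nonneg_left (h7.trans (mul_le_mul_of_nonneg_left h3 h6)) h5.le
  rw [mul_one, mul_left_comm, h4, mul_one] at h8
  linarith

set_option maxHeartbeats 1000000 in
/-- The displacement on `(0, 1/2)`: sign, comparison with the cotangent, and a uniform bound. -/
theorem disp_bounds {c z : ℝ} (hc : 0 ≤ c) (h1 : 0 < z) (h2 : z < 1 / 2) :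
    0 ≤ disp c z ∧ disp c z ≤ c / (2 * Real.pi) * Real.cot (Real.pi * z) ∧
      disp c z ^ 2 ≤ c / 4 ∧
      c / (2 * Real.pi) * Real.cot (Real.pi * z) - disp c z ≤ c ^ 2 / z ^ 3 := by
  obtain ⟨g0, g1, hg⟩ := cos_gammaBase hc h1 h2
  rw [disp_of_mem (by linarith) h2.le]
  set g := gammaBase c z
  have hpi := Real.pi_pos
  have hpi3 := Real.pi_gt_three
  obtain ⟨s0, s1, s2⟩ := one_sub_exp_neg_bounds (s := c / 2) (by linarith)
  rw [← neg_div] at s0 s1 s2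
  set w := 1 - Real.exp (-c / 2) with hw
  have hAlt : Real.pi * z < Real.pi / 2 := by nlinarith
  have hBlt : Real.pi * g < Real.pi / 2 := by nlinarith
  have hA0 : 0 < Real.pi * z := by positivity
  have hcosA : 0 < Real.cos (Real.pi * z) := Real.cos_pos_of_mem_Ioo ⟨by linarith, hAlt⟩
  have hsinA : 0 < Real.sin (Real.pi * z) := Real.sin_pos_of_pos_of_lt_pi hA0 (by linarith)
  have hdiff : Real.cos (Real.pi * z) - Real.cos (Real.pi * g) = w * Real.cos (Real.pi * z) := by
    rw [hg, hw]; ring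
  have hAB : Real.pi * z ≤ Real.pi * g := by
    by_contra hlt
    push Not at hlt
    have := Real.cos_lt_cos_of_nonneg_of_le_pi (x := Real.pi * g) (y := Real.pi * z)
      (by positivity) (by linarith) hlt
    nlinarith
  set A := Real.pi * z
  set B := Real.pi * g
  have hsub : g - z = (B - A) / Real.pi := by
    simp only [A, B]; field_simp
  set d := B - A with hd
  have hd0 : 0 ≤ d := by linarith
  have hBd : B = A + d := by rw [hd]; ring
  have hprod : Real.cos A - Real.cos B = 2 * Real.sin (A + d / 2) * Real.sin (d / 2) := by
    rw [Real.cos_sub_cos, show (A + B) / 2 = A + d / 2 by rw [hBd]; ring,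
      show (A - B) / 2 = -(d / 2) by rw [hBd]; ring, Real.sin_neg]; ring
  have hsd : 2 / Real.pi * (d / 2) ≤ Real.sin (d / 2) :=
    Real.mul_le_sin (by linarith) (by linarith)
  have hsd' : Real.sin (d / 2) ≤ d / 2 := Real.sin_le (by linarith)
  have hcosA1 := Real.cos_le_one A
  have hsinA1 := Real.sin_le_one A
  -- lower bound by the mean value theorem
  have hlow : d * Real.sin A ≤ Real.cos A - Real.cos B := by
    rcases hd0.eq_or_lt with h | h
    · rw [← h, zero_mul, hBd, ← h]; simp
    · obtain ⟨ξ, hξ, he⟩ := exists_hasDerivAt_eq_slope Real.cos (fun x => -Real.sin x)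
        (show A < B by linarith) Real.continuous_cos.continuousOn
        (fun x _ => Real.hasDerivAt_cos x)
      have hs : Real.sin A ≤ Real.sin ξ :=
        Real.sin_le_sin_of_le_of_le_pi_div_two (by linarith) (by linarith [hξ.2]) hξ.1.le
      rw [eq_div_iff (by linarith [hξ.1, hξ.2])] at he
      nlinarith
  have hup : Real.cos A - Real.cos B ≤ d * Real.sin A + d ^ 2 / 2 := by
    have h3 : Real.sin (A + d / 2) ≤ Real.sin A + d / 2 := by
      rw [Real.sin_add]
      have := Real.cos_le_one (d / 2)
      have h6 : Real.cos A * Real.sin (d / 2) ≤ 1 * (d / 2) := by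
        apply mul_le_mul hcosA1 hsd' _ (by norm_num)
        exact le_trans (by positivity) hsd
      nlinarith
    have h4 : 0 ≤ Real.sin (d / 2) := le_trans (by positivity) hsd
    rw [hprod]
    calc 2 * Real.sin (A + d / 2) * Real.sin (d / 2)
        ≤ 2 * (Real.sin A + d / 2) * Real.sin (d / 2) := by gcongr
      _ ≤ 2 * (Real.sin A + d / 2) * (d / 2) := by gcongr
      _ = _ := by ring
  have hcot : Real.cot A = Real.cos A / Real.sin A := Real.cot_eq_cos_div_sin A
  have hdsin : d * Real.sin A ≤ c / 2 * Real.cos A := by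
    rw [hdiff] at hlow
    exact hlow.trans (by gcongr)
  have hzsin : 2 * z ≤ Real.sin A := by
    have := Real.mul_le_sin (x := A) hA0.le hAlt.le
    have e : 2 / Real.pi * A = 2 * z := by simp only [A]; field_simp
    linarith
  refine ⟨by rw [hsub]; positivity, ?_, ?_, ?_⟩
  · rw [hsub, hcot, div_le_iff₀ hpi]
    have : d ≤ c / 2 * Real.cos A / Real.sin A := by rw [le_div_iff₀ hsinA]; exact hdsin
    calc d ≤ c / 2 * Real.cos A / Real.sin A := this
      _ = _ := by field_simp
  · have h3 : Real.sin (d / 2) ≤ Real.sin (A + d / 2) :=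
      Real.sin_le_sin_of_le_of_le_pi_div_two (by linarith) (by linarith) (by linarith)
    have h4 : 0 ≤ 2 / Real.pi * (d / 2) := by positivity
    have h5 : 2 * (2 / Real.pi * (d / 2)) ^ 2 ≤ Real.cos A - Real.cos B := by
      rw [hprod]; nlinarith
    rw [hdiff] at h5
    have h6 : w * Real.cos A ≤ c / 2 := by nlinarith
    rw [hsub]
    have h7 : 2 / Real.pi * (d / 2) = d / Real.pi := by ring
    rw [h7] at h5
    linarith
  · rw [hdiff] at hup
    have hd2 : d ≤ c / 2 / Real.sin A := by
      rw [le_div_iff₀ hsinA]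
      exact hdsin.trans (mul_le_of_le_one_right (by linarith) hcosA1)
    have h3 : c / 2 * Real.cos A - d * Real.sin A ≤ c ^ 2 / 4 / Real.sin A ^ 2 := by
      have h4 : c / 2 * Real.cos A - w * Real.cos A ≤ c ^ 2 / 8 := by
        calc c / 2 * Real.cos A - w * Real.cos A = (c / 2 - w) * Real.cos A := by ring
          _ ≤ c ^ 2 / 8 * 1 := by
            apply mul_le_mul _ hcosA1 hcosA.le (by positivity)
            linarith
          _ = _ := by ring
      have h5 : d ^ 2 ≤ c ^ 2 / 4 / Real.sin A ^ 2 := by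
        calc d ^ 2 ≤ (c / 2 / Real.sin A) ^ 2 := by gcongr
          _ = _ := by ring
      have h6 : c ^ 2 / 4 ≤ c ^ 2 / 4 / Real.sin A ^ 2 := by
        rw [le_div_iff₀ (by positivity)]
        have : Real.sin A ^ 2 ≤ 1 := Real.sin_sq_le_one A
        exact mul_le_of_le_one_right (by positivity) this
      linarith
    have h7 : c / (2 * Real.pi) * Real.cot A - (g - z)
        = (c / 2 * Real.cos A - d * Real.sin A) / (Real.pi * Real.sin A) := by
      rw [hsub, hcot]; field_simp
    rw [h7, div_le_div_iff₀ (by positivity) (by positivity)]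
    have h8 : (c / 2 * Real.cos A - d * Real.sin A) * Real.sin A ^ 2 ≤ c ^ 2 / 4 := by
      rw [le_div_iff₀ (by positivity)] at h3; exact h3
    have h9 : 4 * z ^ 2 ≤ Real.sin A ^ 2 := by nlinarith
    rcases le_total (c / 2 * Real.cos A - d * Real.sin A) 0 with hn | hp
    · have : 0 ≤ c ^ 2 * (Real.pi * Real.sin A) := by positivity
      have : (c / 2 * Real.cos A - d * Real.sin A) * z ^ 3 ≤ 0 :=
        mul_nonpos_of_nonpos_of_nonneg hn (by positivity)
      linarith
    · have h10 : (c / 2 * Real.cos A - d * Real.sin A) * z ^ 2 ≤ c ^ 2 / 16 := by nlinarith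
      have h11 : c ^ 2 * z ≤ c ^ 2 * (Real.pi * Real.sin A) := by
        apply mul_le_mul_of_nonneg_left _ (sq_nonneg c)
        nlinarith
      calc _ = (c / 2 * Real.cos A - d * Real.sin A) * z ^ 2 * z := by ring
        _ ≤ c ^ 2 / 16 * z := by gcongr
        _ ≤ c ^ 2 * z := by nlinarith [mul_nonneg (sq_nonneg c) h1.le]
        _ ≤ _ := h11

theorem abs_disp_le {c : ℝ} (hc : 0 ≤ c) (z : ℝ) : |disp c z| ≤ Real.sqrt c := by
  have key : ∀ z, 0 < z → z < 1 / 2 → |disp c z| ≤ Real.sqrt c := fun z h1 h2 => by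
    refine Real.abs_le_sqrt ?_
    linarith [(disp_bounds hc h1 h2).2.2.1]
  have hper : disp c z = disp c (z - ⌈z - 1 / 2⌉) := by
    simpa using ((disp_periodic c).sub_int_mul_eq (x := z) ⌈z - 1 / 2⌉).symm
  rw [hper]
  set y := z - (⌈z - 1 / 2⌉ : ℝ) with hy
  have l1 := Int.le_ceil (z - 1 / 2)
  have l2 := Int.ceil_lt_add_one (z - 1 / 2)
  have y1 : -(1 / 2) < y := by rw [hy]; linarith
  have y2 : y ≤ 1 / 2 := by rw [hy]; linarith
  rcases lt_trichotomy y 0 with h | h | h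
  · have := key (-y) (by linarith) (by linarith)
    rw [← neg_neg y, disp_neg (by linarith) (by linarith), abs_neg]; exact this
  · rw [h, disp_zero]; simp
  · rcases y2.eq_or_lt with h' | h'
    · rw [h', disp_half]; simp
    · exact key y h h'

theorem cot_bounds {z : ℝ} (h1 : 0 < z) (h2 : z ≤ 1 / 2) :
    0 ≤ Real.cot (Real.pi * z) ∧ Real.cot (Real.pi * z) ≤ 1 / z := by
  have hpi := Real.pi_pos
  have hA0 : 0 < Real.pi * z := by positivity
  have hAlt : Real.pi * z ≤ Real.pi / 2 := by nlinarith
  have hcosA : 0 ≤ Real.cos (Real.pi * z) := Real.cos_nonneg_of_mem_Icc ⟨by linarith, hAlt⟩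
  have hzsin : 2 * z ≤ Real.sin (Real.pi * z) := by
    have := Real.mul_le_sin (x := Real.pi * z) hA0.le hAlt
    have e : 2 / Real.pi * (Real.pi * z) = 2 * z := by field_simp
    linarith
  have hs : 0 < Real.sin (Real.pi * z) := by linarith
  rw [Real.cot_eq_cos_div_sin]
  refine ⟨by positivity, ?_⟩
  rw [div_le_div_iff₀ hs h1]
  nlinarith [Real.cos_le_one (Real.pi * z)]

theorem measurable_cot_pi : Measurable fun z : ℝ => Real.cot (Real.pi * z) := by
  have : (fun z : ℝ => Real.cot (Real.pi * z))
      = fun z => Real.cos (Real.pi * z) / Real.sin (Real.pi * z) :=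
    funext fun z => Real.cot_eq_cos_div_sin _
  rw [this]; fun_prop

theorem periodic_deriv {f : ℝ → ℝ} {T : ℝ} (hf : Function.Periodic f T) :
    Function.Periodic (deriv f) T := fun x => by
  rw [← deriv_comp_add_const]; congr 1; exact funext hf

/-- Uniform and Lipschitz bounds for a `C²` periodic function and its derivative. -/
theorem IsSmoothDensity.exists_bound {h : ℝ → ℝ} (hh : IsSmoothDensity h) :
    ∃ L : ℝ, 0 < L ∧ (∀ x, |h x| ≤ L) ∧
      (∀ x y, |h x - h y| ≤ L * |x - y|) ∧ ∀ x y, |deriv h x - deriv h y| ≤ L * |x - y| := by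
  have c0 : ContDiff ℝ (1 + 1) h := hh.contDiff
  have c1 : ContDiff ℝ 1 (deriv h) := (contDiff_succ_iff_deriv.1 c0).2.2
  have p1 : Function.Periodic (deriv h) 1 := periodic_deriv hh.periodic
  have p2 : Function.Periodic (deriv (deriv h)) 1 := periodic_deriv p1
  obtain ⟨L0, b0⟩ := (hh.periodic.isBounded_of_continuous one_ne_zero
    hh.contDiff.continuous).exists_norm_le
  obtain ⟨L1, b1⟩ := (p1.isBounded_of_continuous one_ne_zero c1.continuous).exists_norm_le
  obtain ⟨L2, b2⟩ := (p2.isBounded_of_continuous one_ne_zero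
    (c1.continuous_deriv le_rfl)).exists_norm_le
  simp only [Set.mem_range, forall_exists_index, forall_apply_eq_imp_iff, Real.norm_eq_abs]
    at b0 b1 b2
  have n0 := (abs_nonneg _).trans (b0 0)
  have n1 := (abs_nonneg _).trans (b1 0)
  have n2 := (abs_nonneg _).trans (b2 0)
  have lip : ∀ (f : ℝ → ℝ) (K : ℝ), Differentiable ℝ f → (∀ x, |deriv f x| ≤ K) →
      ∀ x y, |f x - f y| ≤ K * |x - y| := fun f K hf hK x y =>
    Convex.norm_image_sub_le_of_norm_deriv_le (s := Set.univ) (fun x _ => hf x)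
      (fun x _ => hK x) convex_univ (Set.mem_univ y) (Set.mem_univ x)
  refine ⟨L0 + L1 + L2 + 1, by linarith, fun x => by linarith [b0 x],
    lip h _ (hh.contDiff.differentiable (by norm_num)) fun x => by linarith [b1 x],
    lip _ _ (c1.differentiable (by norm_num)) fun x => by linarith [b2 x]⟩

theorem intervalIntegrable_of_bounded {f : ℝ → ℝ} {a b M : ℝ} (hab : a ≤ b) (hf : Measurable f)
    (hM : ∀ z, a < z → z ≤ b → |f z| ≤ M) : IntervalIntegrable f volume a b := by
  rw [intervalIntegrable_iff_integrableOn_Ioc_of_le hab]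
  refine Measure.integrableOn_of_bounded (M := M) (by simp) hf.aestronglyMeasurable ?_
  exact (ae_restrict_iff' measurableSet_Ioc).2 (ae_of_all _ fun z hz => hM z hz.1 hz.2)

theorem abs_cot_mul_le {z u M : ℝ} (h1 : 0 < z) (h2 : z ≤ 1 / 2) (hu : |u| ≤ M * z) :
    |Real.cot (Real.pi * z) * u| ≤ M := by
  obtain ⟨c0, c1⟩ := cot_bounds h1 h2
  rw [abs_mul, abs_of_nonneg c0]
  calc Real.cot (Real.pi * z) * |u| ≤ 1 / z * (M * z) := by gcongr
    _ = M := by field_simp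

theorem intervalIntegrable_cot_mul {g : ℝ → ℝ} {M : ℝ} (hg : Measurable g)
    (hM : ∀ z, 0 < z → z ≤ 1 / 2 → |g z| ≤ M * z) :
    IntervalIntegrable (fun z => Real.cot (Real.pi * z) * g z) volume 0 (1 / 2) :=
  intervalIntegrable_of_bounded (by norm_num) (measurable_cot_pi.mul hg)
    fun z h1 h2 => abs_cot_mul_le h1 h2 (hM z h1 h2)

theorem abs_integral_cot_mul_le {g : ℝ → ℝ} {M : ℝ}
    (hM : ∀ z, 0 < z → z ≤ 1 / 2 → |g z| ≤ M * z) :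
    |∫ z in (0 : ℝ)..1 / 2, Real.cot (Real.pi * z) * g z| ≤ M / 2 := by
  have := intervalIntegral.norm_integral_le_of_norm_le_const (a := 0) (b := 1 / 2)
    (f := fun z => Real.cot (Real.pi * z) * g z) (C := M) fun z hz => by
      rw [Set.uIoc_of_le (by norm_num)] at hz
      exact abs_cot_mul_le hz.1 hz.2 (hM z hz.1 hz.2)
  rw [Real.norm_eq_abs] at this
  refine this.trans (le_of_eq ?_)
  norm_num
  ring

/-- The drift in symmetrized form. -/
theorem IsSmoothDensity.drift_eq {h : ℝ → ℝ} (hh : IsSmoothDensity h) (x : ℝ) :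
    drift h x = 1 / (2 * Real.pi) *
      ∫ z in (0 : ℝ)..1 / 2, Real.cot (Real.pi * z) * (h (x - z) - h (x + z)) := by
  obtain ⟨L, hL, -, l0, -⟩ := hh.exists_bound
  have hm : Measurable h := hh.contDiff.continuous.measurable
  have i1 := intervalIntegrable_cot_mul (g := fun z => h (x - z) - h x) (M := L) (by fun_prop)
    fun z h1 h2 => by
      have := l0 (x - z) x
      rwa [show x - z - x = -z by ring, abs_neg, abs_of_pos h1] at this
  have i2 := intervalIntegrable_cot_mul (g := fun z => h (x + z) - h x) (M := L) (by fun_prop)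
    fun z h1 h2 => by
      have := l0 (x + z) x
      rwa [show x + z - x = z by ring, abs_of_pos h1] at this
  have key : ∀ z, Real.cot (Real.pi * (1 - z)) * (h (x - (1 - z)) - h x)
      = -(Real.cot (Real.pi * z) * (h (x + z) - h x)) := fun z => by
    have e1 : Real.cot (Real.pi * (1 - z)) = -Real.cot (Real.pi * z) := by
      rw [Real.cot_eq_cos_div_sin, Real.cot_eq_cos_div_sin,
        show Real.pi * (1 - z) = Real.pi - Real.pi * z by ring, Real.cos_pi_sub, Real.sin_pi_sub,
        neg_div]
    have e2 : h (x - (1 - z)) = h (x + z) := by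
      rw [← hh.periodic (x - (1 - z))]; congr 1; ring
    rw [e1, e2]; ring
  have e2 : ∫ z in (1 / 2 : ℝ)..1, Real.cot (Real.pi * z) * (h (x - z) - h x)
      = -∫ z in (0 : ℝ)..1 / 2, Real.cot (Real.pi * z) * (h (x + z) - h x) := by
    have := intervalIntegral.integral_comp_sub_left (a := 0) (b := 1 / 2)
      (fun z => Real.cot (Real.pi * z) * (h (x - z) - h x)) 1
    simp only [key] at this
    rw [intervalIntegral.integral_neg] at this
    rw [this]; norm_num
  have i3 : IntervalIntegrable (fun z => Real.cot (Real.pi * z) * (h (x - z) - h x)) volume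
      (1 / 2) 1 := by
    have := (i2.neg.comp_sub_left 1).symm
    simp only [sub_zero] at this
    refine (this.congr_ae ?_).mono_set ?_
    · refine ae_of_all _ fun z => ?_
      have := key (1 - z)
      rw [sub_sub_cancel] at this
      exact this.symm
    · norm_num
  rw [drift, ← intervalIntegral.integral_add_adjacent_intervals i1 i3, e2, ← sub_eq_add_neg,
    ← intervalIntegral.integral_sub i1 i2]
  congr 2
  ext z
  ring

/-- The mean value inequality, relative to an arbitrary reference slope `m`. -/
theorem abs_sub_sub_mul_le {f : ℝ → ℝ} (hf : Differentiable ℝ f) {x y m C : ℝ}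
    (hC : ∀ ξ ∈ Set.uIcc x y, |deriv f ξ - m| ≤ C) :
    |f x - f y - m * (x - y)| ≤ C * |x - y| := by
  have hd : ∀ ξ, HasDerivAt (fun s => f s - m * s) (deriv f ξ - m) ξ := fun ξ => by
    simpa using (hf ξ).hasDerivAt.fun_sub ((hasDerivAt_id ξ).const_mul m)
  have := Convex.norm_image_sub_le_of_norm_hasDerivWithin_le (s := Set.uIcc x y) (C := C)
    (fun ξ _ => (hd ξ).hasDerivWithinAt) hC (convex_uIcc x y) Set.right_mem_uIcc Set.left_mem_uIcc
  simp only [Real.norm_eq_abs] at this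
  rwa [show f x - m * x - (f y - m * y) = f x - f y - m * (x - y) by ring] at this

/-- The drift is bounded and Lipschitz. -/
theorem IsSmoothDensity.exists_drift_bound {h : ℝ → ℝ} (hh : IsSmoothDensity h) :
    ∃ L : ℝ, 0 < L ∧ (∀ x, |drift h x| ≤ L) ∧
      ∀ x y, |drift h x - drift h y| ≤ L * |x - y| := by
  obtain ⟨L, hL, -, l0, l1⟩ := hh.exists_bound
  have hm : Measurable h := hh.contDiff.continuous.measurable
  have hd : Differentiable ℝ h := hh.contDiff.differentiable (by norm_num)
  have hpi : 1 / (2 * Real.pi) ≤ 1 := by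
    rw [div_le_one (by positivity)]; linarith [Real.pi_gt_three]
  have hpi0 : 0 ≤ 1 / (2 * Real.pi) := by positivity
  have b0 : ∀ x z, 0 < z → z ≤ 1 / 2 → |h (x - z) - h (x + z)| ≤ 2 * L * z := fun x z h1 _ => by
    have := l0 (x - z) (x + z)
    rw [show x - z - (x + z) = -(2 * z) by ring, abs_neg,
      abs_of_pos (show (0 : ℝ) < 2 * z by linarith)] at this
    linarith
  refine ⟨L, hL, fun x => ?_, fun x y => ?_⟩
  · rw [hh.drift_eq, abs_mul, abs_of_nonneg hpi0]
    have := abs_integral_cot_mul_le (b0 x)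
    calc _ ≤ 1 * (2 * L / 2) := by gcongr
      _ = L := by ring
  · have i : ∀ x, IntervalIntegrable
        (fun z => Real.cot (Real.pi * z) * (h (x - z) - h (x + z))) volume 0 (1 / 2) := fun x =>
      intervalIntegrable_cot_mul (g := fun z => h (x - z) - h (x + z)) (by fun_prop) (b0 x)
    rw [hh.drift_eq, hh.drift_eq, ← mul_sub, ← intervalIntegral.integral_sub (i x) (i y), abs_mul,
      abs_of_nonneg hpi0]
    simp only [← mul_sub]
    have b1 : ∀ z, 0 < z → z ≤ 1 / 2 →
        |h (x - z) - h (x + z) - (h (y - z) - h (y + z))| ≤ 2 * L * |x - y| * z := fun z h1 _ => by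
      have hk : Differentiable ℝ fun s => h (s - z) - h (s + z) := by fun_prop
      have := abs_sub_sub_mul_le hk (x := x) (y := y) (m := 0) (C := 2 * L * z) fun ξ _ => by
        have e : deriv (fun s => h (s - z) - h (s + z)) ξ = deriv h (ξ - z) - deriv h (ξ + z) := by
          rw [deriv_fun_sub (by fun_prop) (by fun_prop), deriv_comp_sub_const, deriv_comp_add_const]
        have := l1 (ξ - z) (ξ + z)
        rw [show ξ - z - (ξ + z) = -(2 * z) by ring, abs_neg,
      abs_of_pos (show (0 : ℝ) < 2 * z by linarith)] at this
        rw [e, sub_zero]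
        linarith
      rw [zero_mul, sub_zero] at this
      linarith
    have := abs_integral_cot_mul_le b1
    calc _ ≤ 1 * (2 * L * |x - y| / 2) := by gcongr
      _ = _ := by ring

theorem abs_sub_le_of_mem_uIcc {a x y ξ : ℝ} (hξ : ξ ∈ Set.uIcc x y) :
    |ξ - a| ≤ max |x - a| |y - a| := by
  rw [Set.mem_uIcc] at hξ
  rw [le_max_iff]
  rcases hξ with ⟨h1, h2⟩ | ⟨h1, h2⟩ <;> rcases le_total a ξ with h | h
  · exact Or.inr (by rw [abs_of_nonneg (by linarith), abs_of_nonneg (by linarith)]; linarith)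
  · exact Or.inl (by rw [abs_of_nonpos (by linarith), abs_of_nonpos (by linarith)]; linarith)
  · exact Or.inl (by rw [abs_of_nonneg (by linarith), abs_of_nonneg (by linarith)]; linarith)
  · exact Or.inr (by rw [abs_of_nonpos (by linarith), abs_of_nonpos (by linarith)]; linarith)

theorem le_sqrt_mul_of_le {d z ρ : ℝ} (hd : 0 ≤ d) (h1 : d ≤ z) (h2 : d ≤ ρ) :
    d ≤ Real.sqrt z * Real.sqrt ρ := by
  calc d = Real.sqrt d * Real.sqrt d := (Real.mul_self_sqrt hd).symm
    _ ≤ _ := by gcongr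

/-- The drift is differentiable at every point, with a derivative that is Hölder continuous of
exponent `1/2` in an integrated sense. -/
theorem IsSmoothDensity.exists_slope {h : ℝ → ℝ} (hh : IsSmoothDensity h) (a : ℝ) :
    ∃ m G : ℝ, 0 < G ∧ ∀ x y, |drift h x - drift h y - m * (x - y)| ≤
      G * Real.sqrt (max |x - a| |y - a|) * |x - y| := by
  obtain ⟨L, hL, -, l0, l1⟩ := hh.exists_bound
  have hd : Differentiable ℝ h := hh.contDiff.differentiable (by norm_num)
  have hm : Measurable h := hh.contDiff.continuous.measurable
  have hm' : Measurable (deriv h) := measurable_deriv h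
  have hpi : 1 / (2 * Real.pi) ≤ 1 := by
    rw [div_le_one (by positivity)]; linarith [Real.pi_gt_three]
  have hpi0 : 0 ≤ 1 / (2 * Real.pi) := by positivity
  have b0 : ∀ (f : ℝ → ℝ) (l : ∀ x y, |f x - f y| ≤ L * |x - y|) (x z : ℝ), 0 < z → z ≤ 1 / 2 →
      |f (x - z) - f (x + z)| ≤ 2 * L * z := fun f l x z h1 _ => by
    have := l (x - z) (x + z)
    rw [show x - z - (x + z) = -(2 * z) by ring, abs_neg,
      abs_of_pos (show (0 : ℝ) < 2 * z by linarith)] at this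
    linarith
  have i : ∀ x, IntervalIntegrable
      (fun z => Real.cot (Real.pi * z) * (h (x - z) - h (x + z))) volume 0 (1 / 2) := fun x =>
    intervalIntegrable_cot_mul (g := fun z => h (x - z) - h (x + z)) (by fun_prop) (b0 h l0 x)
  have i' : IntervalIntegrable
      (fun z => Real.cot (Real.pi * z) * (deriv h (a - z) - deriv h (a + z))) volume 0 (1 / 2) :=
    intervalIntegrable_cot_mul (g := fun z => deriv h (a - z) - deriv h (a + z)) (by fun_prop)
      (b0 _ l1 a)
  set J := ∫ z in (0 : ℝ)..1 / 2, z ^ (-(1 / 2) : ℝ) with hJ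
  have hJ0 : 0 ≤ J := intervalIntegral.integral_nonneg (by norm_num) fun z hz =>
    Real.rpow_nonneg hz.1 _
  refine ⟨1 / (2 * Real.pi) * ∫ z in (0 : ℝ)..1 / 2,
    Real.cot (Real.pi * z) * (deriv h (a - z) - deriv h (a + z)), 4 * L * J + 1, by positivity,
    fun x y => ?_⟩
  set ρ := max |x - a| |y - a| with hρ
  have hρ0 : 0 ≤ ρ := (abs_nonneg _).trans (le_max_left _ _)
  have e : drift h x - drift h y - (1 / (2 * Real.pi) * ∫ z in (0 : ℝ)..1 / 2,
      Real.cot (Real.pi * z) * (deriv h (a - z) - deriv h (a + z))) * (x - y)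
      = 1 / (2 * Real.pi) * ∫ z in (0 : ℝ)..1 / 2, Real.cot (Real.pi * z) *
        (h (x - z) - h (x + z) - (h (y - z) - h (y + z))
          - (deriv h (a - z) - deriv h (a + z)) * (x - y)) := by
    have e1 : ∀ z, Real.cot (Real.pi * z) *
        (h (x - z) - h (x + z) - (h (y - z) - h (y + z))
          - (deriv h (a - z) - deriv h (a + z)) * (x - y)) =
        Real.cot (Real.pi * z) * (h (x - z) - h (x + z))
          - Real.cot (Real.pi * z) * (h (y - z) - h (y + z))
          - Real.cot (Real.pi * z) * (deriv h (a - z) - deriv h (a + z)) * (x - y) := fun z => by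
      ring
    simp only [e1]
    rw [intervalIntegral.integral_sub ((i x).sub (i y)) (i'.mul_const _),
      intervalIntegral.integral_sub (i x) (i y), intervalIntegral.integral_mul_const,
      hh.drift_eq, hh.drift_eq]
    ring
  rw [e, abs_mul, abs_of_nonneg hpi0]
  have b1 : ∀ z, 0 < z → z ≤ 1 / 2 → |Real.cot (Real.pi * z) *
        (h (x - z) - h (x + z) - (h (y - z) - h (y + z))
          - (deriv h (a - z) - deriv h (a + z)) * (x - y))| ≤
      4 * L * Real.sqrt ρ * |x - y| * z ^ (-(1 / 2) : ℝ) := fun z h1 h2 => by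
    have hk : Differentiable ℝ fun s => h (s - z) - h (s + z) := by fun_prop
    have := abs_sub_sub_mul_le hk (x := x) (y := y) (m := deriv h (a - z) - deriv h (a + z))
      (C := 4 * L * (Real.sqrt z * Real.sqrt ρ)) fun ξ hξ => by
        have e : deriv (fun s => h (s - z) - h (s + z)) ξ = deriv h (ξ - z) - deriv h (ξ + z) := by
          rw [deriv_fun_sub (by fun_prop) (by fun_prop), deriv_comp_sub_const, deriv_comp_add_const]
        have hξa := abs_sub_le_of_mem_uIcc (a := a) hξ
        rw [e]
        set D := |deriv h (ξ - z) - deriv h (ξ + z) - (deriv h (a - z) - deriv h (a + z))| with hD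
        have t1 : D ≤ 4 * L * z := by
          have := abs_sub (deriv h (ξ - z) - deriv h (ξ + z)) (deriv h (a - z) - deriv h (a + z))
          linarith [b0 _ l1 ξ z h1 h2, b0 _ l1 a z h1 h2]
        have t2 : D ≤ 4 * L * ρ := by
          have p1 := l1 (ξ - z) (a - z)
          have p2 := l1 (ξ + z) (a + z)
          rw [sub_sub_sub_cancel_right] at p1
          rw [add_sub_add_right_eq_sub] at p2
          have p3 : D ≤ |deriv h (ξ - z) - deriv h (a - z)|
              + |deriv h (ξ + z) - deriv h (a + z)| := by
            rw [hD, show deriv h (ξ - z) - deriv h (ξ + z) - (deriv h (a - z) - deriv h (a + z))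
              = (deriv h (ξ - z) - deriv h (a - z)) - (deriv h (ξ + z) - deriv h (a + z)) by ring]
            exact abs_sub _ _
          have : L * |ξ - a| ≤ L * ρ := by gcongr
          nlinarith
        have := le_sqrt_mul_of_le (d := D / (4 * L)) (z := z) (ρ := ρ) (by positivity)
          (by rw [div_le_iff₀ (by positivity)]; linarith)
          (by rw [div_le_iff₀ (by positivity)]; linarith)
        rw [div_le_iff₀ (by positivity)] at this
        linarith
    obtain ⟨c0, c1⟩ := cot_bounds h1 h2
    rw [abs_mul, abs_of_nonneg c0]
    have hz : 1 / z * Real.sqrt z = z ^ (-(1 / 2) : ℝ) := by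
      rw [Real.sqrt_eq_rpow, one_div, ← Real.rpow_neg_one, ← Real.rpow_add h1]; norm_num
    calc _ ≤ 1 / z * (4 * L * (Real.sqrt z * Real.sqrt ρ) * |x - y|) := by gcongr
      _ = 4 * L * Real.sqrt ρ * |x - y| * (1 / z * Real.sqrt z) := by ring
      _ = _ := by rw [hz]
  have := intervalIntegral.norm_integral_le_of_norm_le (μ := volume) (a := 0) (b := 1 / 2)
    (f := fun z => Real.cot (Real.pi * z) * (h (x - z) - h (x + z) - (h (y - z) - h (y + z))
      - (deriv h (a - z) - deriv h (a + z)) * (x - y)))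
    (g := fun z => 4 * L * Real.sqrt ρ * |x - y| * z ^ (-(1 / 2) : ℝ))
    (by norm_num) (ae_of_all _ fun z hz => b1 z hz.1 hz.2)
    ((intervalIntegral.intervalIntegrable_rpow' (by norm_num)).const_mul _)
  rw [intervalIntegral.integral_const_mul, ← hJ, Real.norm_eq_abs] at this
  calc _ ≤ 1 * (4 * L * Real.sqrt ρ * |x - y| * J) := by gcongr
    _ ≤ (4 * L * J + 1) * Real.sqrt ρ * |x - y| := by
      have : 0 ≤ Real.sqrt ρ * |x - y| := by positivity
      linarith

/-- Near a point where the drift has derivative `l`, it is linear up to a Hölder error. -/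
theorem IsSmoothDensity.exists_drift_linearization {h : ℝ → ℝ} (hh : IsSmoothDensity h)
    {a l : ℝ} (ha : HasDerivAt (drift h) l a) :
    ∃ G : ℝ, 0 < G ∧ ∀ x y, |drift h x - drift h y - l * (x - y)| ≤
      G * Real.sqrt (max |x - a| |y - a|) * |x - y| := by
  obtain ⟨m, G, hG, hb⟩ := hh.exists_slope a
  suffices hm : HasDerivAt (drift h) m a by
    rw [ha.unique hm]; exact ⟨G, hG, hb⟩
  rw [hasDerivAt_iff_isLittleO]
  refine Asymptotics.IsLittleO.of_bound fun δ hδ => ?_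
  have : Tendsto (fun x => G * Real.sqrt |x - a|) (𝓝 a) (𝓝 0) := by
    have : Continuous fun x => G * Real.sqrt |x - a| := by fun_prop
    simpa using this.tendsto a
  filter_upwards [this.eventually (gt_mem_nhds hδ)] with x hx
  have := hb x a
  rw [sub_self a, abs_zero, max_eq_left (abs_nonneg _)] at this
  rw [Real.norm_eq_abs, Real.norm_eq_abs, smul_eq_mul, mul_comm (x - a)]
  exact this.trans (by gcongr)

theorem disp_neg' {c z : ℝ} (h1 : 0 < z) (h2 : z ≤ 1 / 2) : disp c (-z) = -disp c z := by
  rcases h2.eq_or_lt with h | h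
  · have := disp_periodic c (-z)
    rw [← this, h, show -(1 / 2 : ℝ) + 1 = 1 / 2 by norm_num, disp_half, neg_zero]
  · exact disp_neg h1 h

theorem disp_bounds' {c z : ℝ} (hc : 0 ≤ c) (h1 : 0 < z) (h2 : z ≤ 1 / 2) :
    0 ≤ disp c z ∧ disp c z ≤ c / (2 * Real.pi) * Real.cot (Real.pi * z) ∧
      disp c z ^ 2 ≤ c / 4 ∧
      c / (2 * Real.pi) * Real.cot (Real.pi * z) - disp c z ≤ c ^ 2 / z ^ 3 := by
  rcases h2.eq_or_lt with h | h
  · have : Real.cot (Real.pi * z) = 0 := by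
      rw [h, mul_one_div, Real.cot_eq_cos_div_sin, Real.cos_pi_div_two, zero_div]
    rw [this, h, disp_half]
    have hz : (0 : ℝ) < (1 / 2) ^ 3 := by norm_num
    refine ⟨le_rfl, by simp, by norm_num; linarith, ?_⟩
    rw [mul_zero, sub_zero]
    exact div_nonneg (sq_nonneg c) hz.le
  · exact disp_bounds hc h1 h

theorem integral_angleLaw {h : ℝ → ℝ} (hh : IsSmoothDensity h) (f : ℝ → ℝ) :
    ∫ t, f t ∂angleLaw h = ∫ t in (0 : ℝ)..1, h t * f t := by
  have hm : Measurable h := hh.contDiff.continuous.measurable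
  rw [angleLaw, integral_withDensity_eq_integral_toReal_smul (by fun_prop)
    (ae_of_all _ fun _ => ENNReal.ofReal_lt_top), integral_Icc_eq_integral_Ioc,
    intervalIntegral.integral_of_le zero_le_one]
  simp only [ENNReal.toReal_ofReal (hh.nonneg _), smul_eq_mul]

/-- Integral of a bounded periodic function of `x - θ` against the law of the attachment angle. -/
theorem integral_sub_angleLaw {h : ℝ → ℝ} (hh : IsSmoothDensity h) {f : ℝ → ℝ} {M : ℝ}
    (hf : Measurable f) (hp : Function.Periodic f 1) (hM : ∀ z, |f z| ≤ M) (x : ℝ) :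
    ∫ t, f (x - t) ∂angleLaw h
      = ∫ z in (0 : ℝ)..1 / 2, (f z * h (x - z) + f (-z) * h (x + z)) := by
  have hm : Measurable h := hh.contDiff.continuous.measurable
  obtain ⟨L, hL, hb, -, -⟩ := hh.exists_bound
  set F : ℝ → ℝ := fun z => f z * h (x - z) with hF
  have hFm : Measurable F := by fun_prop
  have hFp : Function.Periodic F 1 := fun z => by
    have : h (x - (z + 1)) = h (x - z) := by
      rw [← hh.periodic (x - (z + 1))]; congr 1; ring
    simp only [hF, hp z, this]
  have hFb : ∀ z, |F z| ≤ M * L := fun z => by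
    rw [hF, abs_mul]
    exact mul_le_mul (hM z) (hb _) (abs_nonneg _) ((abs_nonneg _).trans (hM z))
  have hi : ∀ a b : ℝ, a ≤ b → IntervalIntegrable F volume a b := fun a b hab =>
    intervalIntegrable_of_bounded hab hFm fun z _ _ => hFb z
  have e1 : ∫ t in (0 : ℝ)..1, h t * f (x - t) = ∫ z in (x - 1)..(x - 1 + 1), F z := by
    have := intervalIntegral.integral_comp_sub_left (a := 0) (b := 1) F x
    rw [show x - 1 + 1 = x - 0 by ring, ← this]
    refine intervalIntegral.integral_congr fun t _ => ?_
    simp only [hF, sub_sub_cancel]; ring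
  have e2 : ∫ z in (-(1 / 2) : ℝ)..0, F z = ∫ z in (0 : ℝ)..1 / 2, F (-z) := by
    rw [intervalIntegral.integral_comp_neg]; simp
  have i2 : IntervalIntegrable (fun z => F (-z)) volume 0 (1 / 2) :=
    intervalIntegrable_of_bounded (by norm_num) (by fun_prop) fun z _ _ => hFb (-z)
  rw [integral_angleLaw hh, e1, hFp.intervalIntegral_add_eq (x - 1) (-(1 / 2)),
    show -(1 / 2 : ℝ) + 1 = 1 / 2 by norm_num,
    ← intervalIntegral.integral_add_adjacent_intervals (hi _ 0 (by norm_num))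
      (hi 0 _ (by norm_num)), e2, ← intervalIntegral.integral_add i2 (hi 0 _ (by norm_num))]
  refine intervalIntegral.integral_congr fun z _ => ?_
  simp only [hF, sub_neg_eq_add]; ring

/-- A function of size `A` concentrated on the scale `√c` has integral of order `A √c`. -/
theorem abs_integral_le_of_concentrated {f : ℝ → ℝ} {A c : ℝ} (hc : 0 < c) (hA : 0 ≤ A)
    (h1 : ∀ z, 0 < z → z ≤ 1 / 2 → |f z| ≤ A)
    (h2 : ∀ z, 0 < z → z ≤ 1 / 2 → |f z| * z ^ 2 ≤ A * c) :
    |∫ z in (0 : ℝ)..1 / 2, f z| ≤ 4 * A * Real.sqrt c := by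
  have hs : 0 < Real.sqrt c := Real.sqrt_pos.2 hc
  have hcont : Continuous fun z : ℝ => 2 * A * (1 / (1 + (z / Real.sqrt c) ^ 2)) := by
    refine continuous_const.mul (continuous_const.div (by fun_prop) fun z => ?_)
    positivity
  have := intervalIntegral.norm_integral_le_of_norm_le (μ := volume) (a := 0) (b := 1 / 2)
    (f := f) (g := fun z => 2 * A * (1 / (1 + (z / Real.sqrt c) ^ 2))) (by norm_num)
    (ae_of_all _ fun z hz => by
      have p1 := h1 z hz.1 hz.2
      have p2 := h2 z hz.1 hz.2
      rw [Real.norm_eq_abs, mul_one_div, le_div_iff₀ (by positivity), div_pow,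
        Real.sq_sqrt hc.le, mul_add, mul_one, ← mul_div_assoc]
      have : |f z| * z ^ 2 / c ≤ A := by rw [div_le_iff₀ hc]; exact p2
      linarith) (hcont.intervalIntegrable _ _)
  rw [intervalIntegral.integral_const_mul, Real.norm_eq_abs,
    intervalIntegral.integral_comp_div (fun z => 1 / (1 + z ^ 2)) hs.ne',
    integral_one_div_one_add_sq, zero_div, Real.arctan_zero, sub_zero, smul_eq_mul] at this
  have ha := Real.arctan_lt_pi_div_two (1 / 2 / Real.sqrt c)
  have hpi := Real.pi_lt_four
  calc _ ≤ _ := this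
    _ ≤ 2 * A * (Real.sqrt c * 2) := by gcongr; linarith
    _ = _ := by ring

/-- First and second moments of one step of the flow. -/
theorem IsSmoothDensity.exists_moment_bound {h : ℝ → ℝ} (hh : IsSmoothDensity h) :
    ∃ C : ℝ, 0 < C ∧ ∀ c, 0 < c → ∀ x,
      |(∫ t, disp c (x - t) ∂angleLaw h) - c * drift h x| ≤ C * (c * Real.sqrt c) ∧
      ∫ t, disp c (x - t) ^ 2 ∂angleLaw h ≤ C * (c * Real.sqrt c) := by
  have hm : Measurable h := hh.contDiff.continuous.measurable
  obtain ⟨L, hL, b0, l0, -⟩ := hh.exists_bound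
  refine ⟨16 * L, by positivity, fun c hc x => ?_⟩
  have hsc : 0 ≤ c * Real.sqrt c := by positivity
  have hdm := measurable_disp c
  have hdb := abs_disp_le hc.le
  have hpi := Real.pi_gt_three
  have cotb : ∀ z, 0 < z → z ≤ 1 / 2 →
      c / (2 * Real.pi) * Real.cot (Real.pi * z) ≤ c / 2 / z := fun z h1 h2 => by
    obtain ⟨c0, c1⟩ := cot_bounds h1 h2
    calc c / (2 * Real.pi) * Real.cot (Real.pi * z) ≤ c / (2 * 1) * (1 / z) := by
          gcongr; linarith
      _ = _ := by ring
  have hsym : ∀ z, 0 < z → z ≤ 1 / 2 → |h (x - z) - h (x + z)| ≤ 2 * L * z := fun z h1 _ => by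
    have := l0 (x - z) (x + z)
    rw [show x - z - (x + z) = -(2 * z) by ring, abs_neg,
      abs_of_pos (show (0 : ℝ) < 2 * z by linarith)] at this
    linarith
  constructor
  · have i1 : IntervalIntegrable (fun z => disp c z * (h (x - z) - h (x + z))) volume 0 (1 / 2) :=
      intervalIntegrable_of_bounded (M := Real.sqrt c * (2 * L)) (by norm_num) (by fun_prop)
        fun z h1 h2 => by
          rw [abs_mul]
          refine mul_le_mul (hdb z) ?_ (abs_nonneg _) (Real.sqrt_nonneg c)
          have := hsym z h1 h2
          nlinarith
    have i2 := intervalIntegrable_cot_mul (g := fun z => h (x - z) - h (x + z)) (by fun_prop) hsym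
    have e1 : ∫ z in (0 : ℝ)..1 / 2, (disp c z * h (x - z) + disp c (-z) * h (x + z))
        = ∫ z in (0 : ℝ)..1 / 2, disp c z * (h (x - z) - h (x + z)) := by
      refine intervalIntegral.integral_congr_ae (ae_of_all _ fun z hz => ?_)
      rw [Set.uIoc_of_le (by norm_num)] at hz
      rw [disp_neg' hz.1 hz.2]; ring
    rw [integral_sub_angleLaw hh hdm (disp_periodic c) hdb, e1, hh.drift_eq, ← mul_assoc, mul_one_div,
      ← intervalIntegral.integral_const_mul, ← intervalIntegral.integral_sub i1 (i2.const_mul _)]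
    refine (abs_integral_le_of_concentrated (A := 2 * L * c) hc (by positivity) ?_ ?_).trans ?_
    · intro z h1 h2
      obtain ⟨d0, d1, -, -⟩ := disp_bounds' hc.le h1 h2
      rw [← mul_assoc, ← sub_mul, abs_mul, abs_of_nonpos (by linarith)]
      calc _ ≤ c / 2 / z * (2 * L * z) := by
            gcongr
            · linarith [cotb z h1 h2]
            · exact hsym z h1 h2
        _ = L * c := by field_simp
        _ ≤ _ := by nlinarith
    · intro z h1 h2
      obtain ⟨d0, d1, -, d3⟩ := disp_bounds' hc.le h1 h2
      rw [← mul_assoc, ← sub_mul, abs_mul, abs_of_nonpos (by linarith)]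
      calc _ ≤ c ^ 2 / z ^ 3 * (2 * L * z) * z ^ 2 := by
            gcongr
            · linarith
            · exact hsym z h1 h2
        _ = _ := by field_simp
    · nlinarith
  · have hsb : ∀ z, |disp c z ^ 2| ≤ c := fun z => by
      have := pow_le_pow_left₀ (abs_nonneg _) (hdb z) 2
      rwa [Real.sq_sqrt hc.le, ← abs_pow] at this
    have hp : Function.Periodic (fun z => disp c z ^ 2) 1 := fun z => by
      simp only [disp_periodic c z]
    have hbound : ∀ z, 0 < z → z ≤ 1 / 2 →
        |disp c z ^ 2 * h (x - z) + disp c (-z) ^ 2 * h (x + z)| ≤ disp c z ^ 2 * (2 * L) :=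
      fun z h1 h2 => by
        rw [disp_neg' h1 h2, neg_sq, ← mul_add, abs_mul, abs_of_nonneg (sq_nonneg _)]
        gcongr
        exact (abs_add_le _ _).trans (by linarith [b0 (x - z), b0 (x + z)])
    rw [integral_sub_angleLaw hh (f := fun z => disp c z ^ 2) (by fun_prop) hp hsb]
    refine (le_abs_self _).trans ((abs_integral_le_of_concentrated (A := 2 * L * c) hc
      (by positivity) ?_ ?_).trans (by nlinarith))
    · intro z h1 h2
      obtain ⟨-, -, d2, -⟩ := disp_bounds' hc.le h1 h2
      refine (hbound z h1 h2).trans ?_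
      nlinarith
    · intro z h1 h2
      obtain ⟨d0, d1, -, -⟩ := disp_bounds' hc.le h1 h2
      have := d1.trans (cotb z h1 h2)
      calc _ ≤ (c / 2 / z) ^ 2 * (2 * L) * z ^ 2 := by
            gcongr
            exact (hbound z h1 h2).trans (by gcongr)
        _ = L * c ^ 2 / 2 := by field_simp
        _ ≤ _ := by nlinarith [mul_pos hL (sq_pos_of_pos hc)]

/-- Freezing: integrate out a coordinate independent of the past. -/
theorem integral_eq_integral_integral_of_indep {Ω α : Type*} {m m0 : MeasurableSpace Ω}
    [MeasurableSpace α] {P : Measure Ω} [IsProbabilityMeasure P] (hm : m ≤ m0) {ξ : Ω → ℝ} (hξ : Measurable ξ)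
    (hind : Indep (MeasurableSpace.comap ξ inferInstance) m P) {Z : Ω → α} (hZ : Measurable[m] Z)
    {g : α × ℝ → ℝ} (hg : Measurable g) (hi : Integrable (fun ω => g (Z ω, ξ ω)) P) :
    ∫ ω, g (Z ω, ξ ω) ∂P = ∫ ω, ∫ t, g (Z ω, t) ∂P.map ξ ∂P := by
  have hZ' : Measurable Z := hZ.mono hm le_rfl
  have : IsProbabilityMeasure (P.map ξ) := Measure.isProbabilityMeasure_map hξ.aemeasurable
  have : IsProbabilityMeasure (P.map Z) := Measure.isProbabilityMeasure_map hZ'.aemeasurable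
  have hI : IndepFun Z ξ P :=
    (indep_of_indep_of_le_right hind hZ.comap_le).symm
  have hmap := (indepFun_iff_map_prod_eq_prod_map_map hZ'.aemeasurable hξ.aemeasurable).1 hI
  have hi' : Integrable g ((P.map Z).prod (P.map ξ)) := by
    rw [← hmap, integrable_map_measure hg.aestronglyMeasurable (by fun_prop)]
    exact hi
  have e1 : ∫ ω, g (Z ω, ξ ω) ∂P = ∫ p, g p ∂P.map fun ω => (Z ω, ξ ω) :=
    (integral_map (by fun_prop) hg.aestronglyMeasurable).symm
  rw [e1, hmap, integral_prod _ hi', integral_map hZ'.aemeasurable]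
  exact hg.stronglyMeasurable.integral_prod_right'.aestronglyMeasurable

/-- Weighted sums of `φ (Y k) (ξ (k + 1))`. -/
noncomputable def weightedSum {Ω : Type*} (a : ℕ → ℝ) (φ : ℝ → ℝ → ℝ) (Y ξ : ℕ → Ω → ℝ) (n : ℕ)
    (ω : Ω) : ℝ :=
  ∑ k ∈ Finset.range n, a k * φ (Y k ω) (ξ (k + 1) ω)

/-- Doob's inequality for weighted sums of centred increments driven by an i.i.d. sequence. -/
theorem measure_exists_le_abs_weightedSum_le {Ω : Type*} [MeasurableSpace Ω] {P : Measure Ω}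
    [IsProbabilityMeasure P] {ξ : ℕ → Ω → ℝ} (hξ : ∀ n, StronglyMeasurable (ξ n))
    (hind : iIndepFun ξ P) {ν : Measure ℝ} (hν : ∀ n, P.map (ξ n) = ν) {Y : ℕ → Ω → ℝ}
    (hY : ∀ n, Measurable[Filtration.natural ξ hξ n] (Y n)) {φ : ℝ → ℝ → ℝ}
    (hφ : Measurable (Function.uncurry φ)) {B V : ℝ} (hB : ∀ x t, |φ x t| ≤ B)
    (h0 : ∀ x, ∫ t, φ x t ∂ν = 0) (hV : ∀ x, ∫ t, φ x t ^ 2 ∂ν ≤ V) (a : ℕ → ℝ) {K : ℝ}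
    (hK : 0 < K) (N : ℕ) :
    P {ω | ∃ n ≤ N, K ≤ |weightedSum a φ Y ξ n ω|} ≤
      ENNReal.ofReal (V * (∑ k ∈ Finset.range N, a k ^ 2) / K ^ 2) := by
  set F := Filtration.natural ξ hξ with hF
  have hνp : IsProbabilityMeasure ν := by
    rw [← hν 0]; exact Measure.isProbabilityMeasure_map (hξ 0).measurable.aemeasurable
  have hξF : ∀ n, Measurable[F n] (ξ n) := fun n =>
    ((Filtration.stronglyAdapted_natural hξ) n).measurable
  set W := weightedSum a φ Y ξ with hW
  have hWs : ∀ n ω, W (n + 1) ω = W n ω + a n * φ (Y n ω) (ξ (n + 1) ω) := fun n ω =>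
    Finset.sum_range_succ _ _
  have hWm : ∀ n, Measurable[F n] (W n) := fun n => by
    refine Finset.measurable_sum _ fun k hk => ?_
    have hk := Finset.mem_range.1 hk
    have h1 : Measurable[F n] (Y k) := (hY k).mono (F.mono hk.le) le_rfl
    have h2 : Measurable[F n] (ξ (k + 1)) := (hξF (k + 1)).mono (F.mono hk) le_rfl
    exact (hφ.comp (h1.prodMk h2)).const_mul (a k)
  have hWm' : ∀ n, Measurable (W n) := fun n => (hWm n).mono (F.le n) le_rfl
  have hWb : ∀ n ω, |W n ω| ≤ ∑ k ∈ Finset.range n, |a k| * B := fun n ω => by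
    refine (Finset.abs_sum_le_sum_abs _ _).trans (Finset.sum_le_sum fun k _ => ?_)
    rw [abs_mul]
    exact mul_le_mul_of_nonneg_left (hB _ _) (abs_nonneg _)
  have hWi : ∀ n, Integrable (fun ω => W n ω ^ 2) P := fun n =>
    Integrable.of_bound ((hWm' n).pow_const 2).aestronglyMeasurable
      ((∑ k ∈ Finset.range n, |a k| * B) ^ 2) (ae_of_all _ fun ω => by
        rw [Real.norm_eq_abs, abs_pow]
        exact pow_le_pow_left₀ (abs_nonneg _) (hWb n ω) 2)
  have hφm : ∀ x, Measurable (φ x) := fun x => hφ.comp measurable_prodMk_left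
  have hφi : ∀ x, Integrable (φ x) ν := fun x =>
    Integrable.of_bound (hφm x).aestronglyMeasurable B (ae_of_all _ (hB x))
  have hφi2 : ∀ x, Integrable (fun t => φ x t ^ 2) ν := fun x =>
    Integrable.of_bound ((hφm x).pow_const 2).aestronglyMeasurable (B ^ 2) (ae_of_all _ fun t => by
      rw [Real.norm_eq_abs, abs_pow]
      exact pow_le_pow_left₀ (abs_nonneg _) (hB x t) 2)
  have hQm : StronglyMeasurable fun x => ∫ t, φ x t ^ 2 ∂ν :=
    (hφ.pow_const 2).stronglyMeasurable.integral_prod_right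
  have hV' : ∀ x, 0 ≤ ∫ t, φ x t ^ 2 ∂ν := fun x => integral_nonneg fun t => sq_nonneg _
  have hYm' : ∀ n, Measurable (Y n) := fun n => (hY n).mono (F.le n) le_rfl
  have hQi : ∀ n, Integrable (fun ω => ∫ t, φ (Y n ω) t ^ 2 ∂ν) P := fun n =>
    Integrable.of_bound (hQm.measurable.comp (hYm' n)).aestronglyMeasurable V
      (ae_of_all _ fun ω => by
        rw [Real.norm_eq_abs, abs_of_nonneg (hV' _)]; exact hV _)
  have key : ∀ n (s : Set Ω), MeasurableSet[F n] s → ∫ ω in s, W (n + 1) ω ^ 2 ∂P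
      = ∫ ω in s, W n ω ^ 2 ∂P + a n ^ 2 * ∫ ω in s, ∫ t, φ (Y n ω) t ^ 2 ∂ν ∂P := by
    intro n s hs
    have hs' : MeasurableSet s := F.le n s hs
    set Z : Ω → ℝ × ℝ × ℝ := fun ω => (s.indicator 1 ω, W n ω, Y n ω) with hZ
    have hsm : Measurable[F n] (s.indicator (1 : Ω → ℝ)) :=
      Measurable.indicator (@measurable_const _ _ _ (F n) 1) hs
    have hZm : Measurable[F n] Z := hsm.prodMk ((hWm n).prodMk (hY n))
    set g : (ℝ × ℝ × ℝ) × ℝ → ℝ := fun p => p.1.1 * (p.1.2.1 + a n * φ p.1.2.2 p.2) ^ 2 with hg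
    have hgm : Measurable g := by
      have : Measurable fun p : (ℝ × ℝ × ℝ) × ℝ => φ p.1.2.2 p.2 :=
        hφ.comp (by fun_prop : Measurable fun p : (ℝ × ℝ × ℝ) × ℝ => (p.1.2.2, p.2))
      fun_prop
    have e : ∀ ω, g (Z ω, ξ (n + 1) ω) = s.indicator (fun ω => W (n + 1) ω ^ 2) ω := fun ω => by
      by_cases hω : ω ∈ s <;> simp [hg, hZ, hω, hWs]
    have hgi : Integrable (fun ω => g (Z ω, ξ (n + 1) ω)) P := by
      simp only [e]
      exact (hWi (n + 1)).indicator hs'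
    have := integral_eq_integral_integral_of_indep (F.le n) (hξ (n + 1)).measurable
      (hind.indep_comap_natural_of_lt hξ (Nat.lt_succ_self n)) hZm hgm hgi
    simp only [e] at this
    rw [integral_indicator hs', hν] at this
    have e2 : ∀ ω, ∫ t, g (Z ω, t) ∂ν = s.indicator (fun ω => W n ω ^ 2) ω
        + a n ^ 2 * s.indicator (fun ω => ∫ t, φ (Y n ω) t ^ 2 ∂ν) ω := fun ω => by
      have e3 : ∀ t, g (Z ω, t) = s.indicator 1 ω *
          (W n ω ^ 2 + 2 * W n ω * a n * φ (Y n ω) t + a n ^ 2 * φ (Y n ω) t ^ 2) := fun t => by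
        simp only [hg, hZ]; ring
      simp only [e3]
      rw [integral_const_mul, integral_add (by fun_prop) ((hφi2 _).const_mul _),
        integral_add (by fun_prop) ((hφi _).const_mul _), integral_const_mul, integral_const_mul,
        h0, integral_const]
      by_cases hω : ω ∈ s <;> simp [hω]
    simp only [e2] at this
    rw [this, integral_add ((hWi n).indicator hs') (((hQi n).indicator hs').const_mul _),
      integral_const_mul, integral_indicator hs', integral_indicator hs']
  have hsub : Submartingale (fun n ω => W n ω ^ 2) F P := by
    refine submartingale_of_setIntegral_le_succ (fun n => ((hWm n).pow_const 2).stronglyMeasurable)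
      hWi fun n s hs => ?_
    rw [key n s hs]
    have : 0 ≤ ∫ ω in s, ∫ t, φ (Y n ω) t ^ 2 ∂ν ∂P := integral_nonneg fun ω => hV' _
    have := mul_nonneg (sq_nonneg (a n)) this
    linarith
  have hvar : ∀ n, ∫ ω, W n ω ^ 2 ∂P ≤ V * ∑ k ∈ Finset.range n, a k ^ 2 := fun n => by
    induction n with
    | zero => simp [hW, weightedSum]
    | succ n ih =>
      have := key n Set.univ MeasurableSet.univ
      simp only [Measure.restrict_univ] at this
      have hq : ∫ ω, ∫ t, φ (Y n ω) t ^ 2 ∂ν ∂P ≤ V := by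
        have := integral_mono (hQi n) (integrable_const V) fun ω => hV (Y n ω)
        simpa using this
      rw [this, Finset.sum_range_succ]
      nlinarith [sq_nonneg (a n), mul_le_mul_of_nonneg_left hq (sq_nonneg (a n))]
  have hmax := maximal_ineq hsub (fun n ω => sq_nonneg (W n ω)) (ε := (K ^ 2).toNNReal) N
  set S : Set Ω := {ω | ((K ^ 2).toNNReal : ℝ) ≤
    (Finset.range (N + 1)).sup' Finset.nonempty_range_add_one fun k => W k ω ^ 2} with hS
  have hsubset : {ω | ∃ n ≤ N, K ≤ |W n ω|} ⊆ S := by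
    rintro ω ⟨n, hn, hKn⟩
    rw [hS, Set.mem_ofPred_eq, Finset.le_sup'_iff, Real.coe_toNNReal _ (sq_nonneg K)]
    refine ⟨n, Finset.mem_range.2 (Nat.lt_succ_of_le hn), ?_⟩
    rw [← sq_abs (W n ω)]
    exact pow_le_pow_left₀ hK.le hKn 2
  have hle : ∫ ω in S, W N ω ^ 2 ∂P ≤ V * ∑ k ∈ Finset.range N, a k ^ 2 :=
    (setIntegral_le_integral (hWi N) (ae_of_all _ fun ω => sq_nonneg _)).trans (hvar N)
  rw [ENNReal.ofReal_div_of_pos (by positivity), ENNReal.le_div_iff_mul_le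
    (Or.inl (by simpa using hK.ne')) (Or.inl ENNReal.ofReal_ne_top), mul_comm]
  calc _ ≤ ENNReal.ofReal (K ^ 2) * P S := by gcongr
    _ ≤ _ := hmax
    _ ≤ _ := ENNReal.ofReal_le_ofReal hle

/-- A bounded Lipschitz field on the line has a solution for all positive times. -/
theorem exists_isODESolution {b : ℝ → ℝ} {L : ℝ} (hL : 0 < L) (hb : ∀ x, |b x| ≤ L)
    (hl : ∀ x y, |b x - b y| ≤ L * |x - y|) (x : ℝ) : ∃ y, IsODESolution b x y := by
  have hlip : LipschitzWith L.toNNReal b := LipschitzWith.of_dist_le_mul fun x y => by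
    rw [Real.dist_eq, Real.dist_eq, Real.coe_toNNReal _ hL.le]; exact hl x y
  have hex : ∀ n : ℕ, ∃ f : ℝ → ℝ, f 0 = x ∧
      ∀ t ∈ Set.Icc (0 : ℝ) n, HasDerivWithinAt f (b (f t)) (Set.Icc 0 (n : ℝ)) t := fun n => by
    have hP : IsPicardLindelof (fun _ => b) (tmin := 0) (tmax := n)
        ⟨0, Set.left_mem_Icc.2 n.cast_nonneg⟩ x (L.toNNReal * n) 0 L.toNNReal L.toNNReal :=
      IsPicardLindelof.of_time_independent
        (fun z _ => by rw [Real.norm_eq_abs, Real.coe_toNNReal _ hL.le]; exact hb z)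
        hlip.lipschitzOnWith (by simp)
    obtain ⟨f, h0, hf⟩ := hP.exists_eq_forall_mem_Icc_hasDerivWithinAt₀
    exact ⟨f, h0, hf⟩
  choose f f0 hf using hex
  have hIci : ∀ (n : ℕ) (t : ℝ), t ∈ Set.Ico (0 : ℝ) n →
      HasDerivWithinAt (f n) (b (f n t)) (Set.Ici 0) t := fun n t ht => by
    have h2 : Set.Icc (0 : ℝ) n =ᶠ[𝓝 t] Set.Ici 0 := by
      filter_upwards [gt_mem_nhds ht.2] with s hs
      exact propext ⟨fun h => h.1, fun h => ⟨h, hs.le⟩⟩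
    exact (hasDerivWithinAt_congr_set h2).1 (hf n t ⟨ht.1, ht.2.le⟩)
  have heq : ∀ (m n : ℕ), m ≤ n → ∀ t ∈ Set.Icc (0 : ℝ) m, f m t = f n t := fun m n hmn => by
    have hc : (m : ℝ) ≤ n := by exact_mod_cast hmn
    refine ODE_solution_unique_of_mem_Icc_right (v := fun _ => b) (s := fun _ => Set.univ)
      (K := L.toNNReal) (fun t _ => hlip.lipschitzOnWith)
      (fun t ht => (hf m t ht).continuousWithinAt) (fun t ht => ?_) (fun _ _ => Set.mem_univ _)
      (fun t ht => ((hf n t ⟨ht.1, ht.2.trans hc⟩).continuousWithinAt).mono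
        (Set.Icc_subset_Icc_right hc)) (fun t ht => ?_) (fun _ _ => Set.mem_univ _)
      ((f0 m).trans (f0 n).symm)
    · exact (hIci m t ht).mono (Set.Ici_subset_Ici.2 ht.1)
    · exact (hIci n t ⟨ht.1, ht.2.trans_le hc⟩).mono (Set.Ici_subset_Ici.2 ht.1)
  refine ⟨fun t => f (⌊t⌋₊ + 1) t, f0 _, fun t ht => ?_⟩
  set N := ⌊t⌋₊ + 1 with hN
  have htN : t < N := by rw [hN]; exact_mod_cast Nat.lt_floor_add_one t
  refine (hIci N t ⟨ht, htN⟩).congr_of_eventuallyEq ?_ rfl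
  have h1 : ∀ᶠ s : ℝ in 𝓝[Set.Ici 0] t, s < N := nhdsWithin_le_nhds (gt_mem_nhds htN)
  filter_upwards [h1, self_mem_nhdsWithin] with s hs hs0
  have hs0 : 0 ≤ s := hs0
  refine heq _ _ ?_ s ⟨hs0, ?_⟩
  · exact Nat.succ_le_of_lt ((Nat.floor_lt hs0).2 hs)
  · exact_mod_cast (Nat.lt_floor_add_one s).le

theorem psi_isODESolution {b : ℝ → ℝ} {L : ℝ} (hL : 0 < L) (hb : ∀ x, |b x| ≤ L)
    (hl : ∀ x y, |b x - b y| ≤ L * |x - y|) (x : ℝ) : IsODESolution b x fun t => psi b t x :=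
  Classical.epsilon_spec (exists_isODESolution hL hb hl x)

/-- A solution of an ODE with field bounded by `L` is `L`-Lipschitz in time. -/
theorem IsODESolution.abs_sub_le {b y : ℝ → ℝ} {x L : ℝ} (hy : IsODESolution b x y)
    (hb : ∀ x, |b x| ≤ L) {s t : ℝ} (hs : 0 ≤ s) (ht : 0 ≤ t) : |y t - y s| ≤ L * |t - s| :=
  Convex.norm_image_sub_le_of_norm_hasDerivWithin_le (fun u hu => hy.2 u hu) (fun _ _ => hb _)
    (convex_Ici 0) hs ht

/-- One Euler step has an error quadratic in the step size. -/
theorem IsODESolution.abs_euler_le {b y : ℝ → ℝ} {x L : ℝ} (hy : IsODESolution b x y)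
    (hL : 0 < L) (hb : ∀ x, |b x| ≤ L) (hl : ∀ x y, |b x - b y| ≤ L * |x - y|) {s c : ℝ}
    (hs : 0 ≤ s) (hc : 0 ≤ c) : |y (s + c) - y s - c * b (y s)| ≤ L ^ 2 * c ^ 2 := by
  have hd : ∀ u ∈ Set.Icc s (s + c),
      HasDerivWithinAt (fun u => y u - u * b (y s)) (b (y u) - b (y s)) (Set.Icc s (s + c)) u :=
    fun u hu => by
      have h1 := (hy.2 u (hs.trans hu.1)).mono (Set.Icc_subset_Ici_self.trans (Set.Ici_subset_Ici.2 hs) :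
        Set.Icc s (s + c) ⊆ Set.Ici 0)
      simpa using h1.fun_sub ((hasDerivAt_id u).hasDerivWithinAt.mul_const (b (y s)))
  have := Convex.norm_image_sub_le_of_norm_hasDerivWithin_le (C := L * (L * c)) hd (fun u hu => by
    have h1 := hy.abs_sub_le hb hs (hs.trans hu.1)
    rw [abs_of_nonneg (sub_nonneg.2 hu.1)] at h1
    refine (hl _ _).trans ?_
    gcongr
    exact h1.trans (by gcongr; linarith [hu.2])) (convex_Icc _ _)
    (Set.left_mem_Icc.2 (by linarith)) (Set.right_mem_Icc.2 (by linarith))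
  rw [Real.norm_eq_abs, Real.norm_eq_abs, add_sub_cancel_left, abs_of_nonneg hc] at this
  rw [show y (s + c) - y s - c * b (y s) = y (s + c) - (s + c) * b (y s) - (y s - s * b (y s)) by
    ring]
  exact this.trans (le_of_eq (by ring))

theorem sum_inv_pow_le {l c : ℝ} (hl : 0 < l) (hc : 0 < c) (n : ℕ) :
    ∑ k ∈ Finset.range n, 1 / (1 + l * c) ^ (k + 1) ≤ 1 / (l * c) := by
  have hq : 0 < 1 + l * c := by positivity
  have : ∑ k ∈ Finset.range n, 1 / (1 + l * c) ^ (k + 1)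
      = (1 - 1 / (1 + l * c) ^ n) / (l * c) := by
    induction n with
    | zero => simp
    | succ n ih => rw [Finset.sum_range_succ, ih, pow_succ]; field_simp; ring
  rw [this]
  gcongr
  have : 0 < 1 / (1 + l * c) ^ n := by positivity
  linarith

theorem abs_sum_div_pow_le {l c A : ℝ} (hl : 0 < l) (hc : 0 < c) {f : ℕ → ℝ} (n : ℕ)
    (hf : ∀ k < n, |f k| ≤ A) (hA : 0 ≤ A) :
    |∑ k ∈ Finset.range n, f k / (1 + l * c) ^ (k + 1)| ≤ A / (l * c) := by
  have hq : 0 < 1 + l * c := by positivity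
  calc _ ≤ ∑ k ∈ Finset.range n, A * (1 / (1 + l * c) ^ (k + 1)) := by
        refine (Finset.abs_sum_le_sum_abs _ _).trans (Finset.sum_le_sum fun k hk => ?_)
        rw [abs_div, abs_of_pos (pow_pos hq _), mul_one_div]
        gcongr
        exact hf k (Finset.mem_range.1 hk)
    _ = A * ∑ k ∈ Finset.range n, 1 / (1 + l * c) ^ (k + 1) := by rw [Finset.mul_sum]
    _ ≤ A * (1 / (l * c)) := by gcongr; exact sum_inv_pow_le hl hc n
    _ = _ := by ring

theorem mul_sum_sqrt_pow_le {l c : ℝ} (hl : 0 < l) (hc : 0 < c) (hlc : l * c ≤ 3) (n : ℕ) :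
    c * ∑ k ∈ Finset.range n, Real.sqrt (1 + l * c) ^ k ≤ 3 / l * Real.sqrt (1 + l * c) ^ n := by
  set p := Real.sqrt (1 + l * c) with hp
  have hp0 : 0 ≤ p := Real.sqrt_nonneg _
  have hp2 : p ^ 2 = 1 + l * c := Real.sq_sqrt (by positivity)
  have hp1 : 1 ≤ p := by rw [hp, Real.one_le_sqrt]; linarith [mul_pos hl hc]
  have hple : p ≤ 2 := by nlinarith
  induction n with
  | zero => simp; positivity
  | succ n ih =>
    rw [Finset.sum_range_succ, mul_add, pow_succ]
    have h1 : l * c ≤ 3 * (p - 1) := by nlinarith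
    have h2 : c ≤ 3 / l * (p - 1) := by
      rw [div_mul_eq_mul_div, le_div_iff₀ hl]; linarith
    have h3 := mul_le_mul_of_nonneg_right h2 (pow_nonneg hp0 n)
    nlinarith

/-- Growth of a perturbed linear recursion: a nonlinear term of Hölder type does not change the
exponential rate as long as the trajectory is small. -/
theorem abs_le_of_linear_recursion {l c κ H : ℝ} (hl : 0 < l) (hc : 0 < c) (hlc : l * c ≤ 3)
    (hκ : 0 ≤ κ) (hH0 : 0 ≤ H) {v g e : ℕ → ℝ} {N : ℕ}
    (hv : ∀ n < N, v (n + 1) = (1 + l * c) * v n + c * g n + e n)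
    (he : ∀ n ≤ N, |v 0 + ∑ k ∈ Finset.range n, e k / (1 + l * c) ^ (k + 1)| ≤ κ)
    (hg : ∀ n < N, |v n| ≤ 2 * κ * (1 + l * c) ^ n →
      |g n| ≤ H * Real.sqrt (1 + l * c) ^ n * (2 * κ * (1 + l * c) ^ n))
    (hH : 3 / l * H * Real.sqrt (1 + l * c) ^ N ≤ 1 / 2) :
    ∀ n ≤ N, |v n| ≤ 2 * κ * (1 + l * c) ^ n := by
  have hsum := mul_sum_sqrt_pow_le hl hc hlc
  have hq1 : 1 ≤ 1 + l * c := by linarith [mul_pos hl hc]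
  set q := 1 + l * c
  have hq : 0 < q := by linarith
  set p := Real.sqrt q
  have hp1 : 1 ≤ p := Real.one_le_sqrt.2 hq1
  have hsol : ∀ n ≤ N, v n = q ^ n * (v 0 + ∑ k ∈ Finset.range n, e k / q ^ (k + 1)
      + ∑ k ∈ Finset.range n, c * g k / q ^ (k + 1)) := fun n => by
    induction n with
    | zero => simp
    | succ n ih =>
      intro hn
      rw [hv n hn, ih (Nat.le_of_succ_le hn), Finset.sum_range_succ, Finset.sum_range_succ,
        pow_succ]
      field_simp
      ring
  intro n
  induction n using Nat.strong_induction_on with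
  | _ n ih =>
    intro hn
    rw [hsol n hn, abs_mul, abs_of_pos (pow_pos hq n), mul_comm]
    refine mul_le_mul_of_nonneg_right ?_ (pow_pos hq n).le
    have h1 : |∑ k ∈ Finset.range n, c * g k / q ^ (k + 1)| ≤ κ := by
      calc _ ≤ ∑ k ∈ Finset.range n, 2 * κ * H * (c * p ^ k) := by
            refine (Finset.abs_sum_le_sum_abs _ _).trans (Finset.sum_le_sum fun k hk => ?_)
            have hk := Finset.mem_range.1 hk
            have hgk := hg k (hk.trans_le hn) (ih k hk (hk.le.trans hn))
            rw [abs_div, abs_mul, abs_of_pos hc, abs_of_pos (pow_pos hq _),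
              div_le_iff₀ (pow_pos hq _)]
            calc c * |g k| ≤ c * (H * p ^ k * (2 * κ * q ^ k)) := by gcongr
              _ = 2 * κ * H * (c * p ^ k) * q ^ k := by ring
              _ ≤ _ := by gcongr; exact Nat.le_succ k
        _ = 2 * κ * H * (c * ∑ k ∈ Finset.range n, p ^ k) := by
            rw [← Finset.mul_sum, ← Finset.mul_sum]
        _ ≤ 2 * κ * H * (3 / l * p ^ N) := by
            refine mul_le_mul_of_nonneg_left ((hsum n).trans ?_) (by positivity)
            exact mul_le_mul_of_nonneg_left (pow_le_pow_right₀ hp1 hn) (by positivity)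
        _ = 2 * κ * (3 / l * H * p ^ N) := by ring
        _ ≤ 2 * κ * (1 / 2) := by gcongr
        _ = κ := by ring
    exact (abs_add_le _ _).trans (by linarith [he n hn])

/-- Discrete Gronwall inequality with additive noise controlled through its partial sums. -/
theorem abs_le_of_lipschitz_recursion {c L σ : ℝ} (hc : 0 ≤ c) (hL : 0 ≤ L) {v g e : ℕ → ℝ}
    {N : ℕ} (hv : ∀ n < N, v (n + 1) = v n + c * g n + e n)
    (hg : ∀ n < N, |g n| ≤ L * |v n|) (he : ∀ n ≤ N, |∑ k ∈ Finset.range n, e k| ≤ σ) :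
    ∀ n ≤ N, |v n| ≤ (|v 0| + σ) * Real.exp (L * (c * n)) := by
  have hsol : ∀ n ≤ N, v n = v 0 + ∑ k ∈ Finset.range n, e k
      + ∑ k ∈ Finset.range n, c * g k := fun n => by
    induction n with
    | zero => simp
    | succ n ih =>
      intro hn
      rw [hv n hn, ih (Nat.le_of_succ_le hn), Finset.sum_range_succ, Finset.sum_range_succ]
      ring
  have hle : ∀ n ≤ N, |v n| ≤ |v 0| + σ + ∑ k ∈ Finset.range n, c * (L * |v k|) := fun n hn => by
    rw [hsol n hn]
    have h1 : |∑ k ∈ Finset.range n, c * g k| ≤ ∑ k ∈ Finset.range n, c * (L * |v k|) := by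
      refine (Finset.abs_sum_le_sum_abs _ _).trans (Finset.sum_le_sum fun k hk => ?_)
      rw [abs_mul, abs_of_nonneg hc]
      exact mul_le_mul_of_nonneg_left (hg k ((Finset.mem_range.1 hk).trans_le hn)) hc
    have h2 := abs_add_le (v 0 + ∑ k ∈ Finset.range n, e k) (∑ k ∈ Finset.range n, c * g k)
    have h3 := abs_add_le (v 0) (∑ k ∈ Finset.range n, e k)
    linarith [he n hn]
  have hexp : ∀ n ≤ N, |v 0| + σ + ∑ k ∈ Finset.range n, c * (L * |v k|)
      ≤ (|v 0| + σ) * Real.exp (L * (c * n)) := fun n => by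
    induction n with
    | zero => simp
    | succ n ih =>
      intro hn
      have ih := ih (Nat.le_of_succ_le hn)
      have h1 := hle n (Nat.le_of_succ_le hn)
      rw [Finset.sum_range_succ]
      set U := |v 0| + σ + ∑ k ∈ Finset.range n, c * (L * |v k|)
      have hU : 0 ≤ U := (abs_nonneg _).trans h1
      have e1 : L * (c * ((n + 1 : ℕ) : ℝ)) = L * (c * n) + c * L := by push_cast; ring
      rw [e1, Real.exp_add, ← mul_assoc (|v 0| + σ)]
      have h2 : 1 + c * L ≤ Real.exp (c * L) := by linarith [Real.add_one_le_exp (c * L)]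
      calc |v 0| + σ + (∑ k ∈ Finset.range n, c * (L * |v k|) + c * (L * |v n|))
          = U + c * (L * |v n|) := by ring
        _ ≤ U + c * (L * U) := by gcongr
        _ = U * (1 + c * L) := by ring
        _ ≤ U * Real.exp (c * L) := by gcongr
        _ ≤ _ := by gcongr
  exact fun n hn => (hle n hn).trans (hexp n hn)

/-- The path of a noisy Euler scheme near an unstable fixed point, compared with the solution of
the ODE started from the scheme at step `k₀`. The bounds on the noise `m` are on discounted sums
up to step `k₁` and on plain sums afterwards. -/
theorem abs_sub_solution_le {b : ℝ → ℝ} {L G a l : ℝ} (hL : 0 < L) (hb : ∀ x, |b x| ≤ L)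
    (hlip : ∀ x y, |b x - b y| ≤ L * |x - y|) (hl : 0 < l) (hG : 0 < G) (ha : b a = 0)
    (hlin : ∀ x y, |b x - b y - l * (x - y)| ≤ G * Real.sqrt (max |x - a| |y - a|) * |x - y|)
    {c s C K κ δ σ τ : ℝ} (hc : 0 < c) (hs : 0 < s) (hlc : l * c ≤ 3) (hC : 0 < C)
    (hK : 0 < K) (hκ : 0 < κ)
    (hsmallK : (C * s ^ 2 + L ^ 2 * c) / l ≤ K * s) (hsmallκ : (C * s ^ 2 + L ^ 2 * c) / l ≤ κ * s)
    {x r m : ℕ → ℝ} (hx0 : x 0 = a) (hx : ∀ n, x (n + 1) = x n + c * b (x n) + r n + m n)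
    (hr : ∀ n, |r n| ≤ C * (c * s ^ 2)) {k₀ k₁ N : ℕ} (hk : k₀ ≤ k₁) (hkN : k₁ ≤ N)
    (hδ : s * (1 + l * c) ^ k₁ ≤ δ) (hGδ : 3 / l * G * Real.sqrt (10 * K * δ) ≤ 1 / 2)
    (hτ : c * ((N : ℝ) - k₁) ≤ τ)
    (A1 : ∀ n ≤ k₁, |∑ k ∈ Finset.range n, m k / (1 + l * c) ^ (k + 1)| ≤ K * s)
    (A2 : ∀ j, k₀ + j ≤ k₁ →
      |∑ i ∈ Finset.range j, m (k₀ + i) / (1 + l * c) ^ (k₀ + i + 1)| ≤ κ * s)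
    (A3 : ∀ j, k₁ + j ≤ N → |∑ i ∈ Finset.range j, m (k₁ + i)| ≤ σ)
    {y : ℝ → ℝ} (hy : IsODESolution b (x k₀) y) :
    ∀ j, k₀ + j ≤ N →
      |x (k₀ + j) - y (c * j)| ≤ (4 * κ * δ + σ + τ * (C * s ^ 2 + L ^ 2 * c)) * Real.exp (L * τ) := by
  set q := 1 + l * c with hq
  have hq1 : 1 ≤ q := by linarith [mul_pos hl hc]
  have hq0 : 0 < q := by linarith
  set p := Real.sqrt q with hp
  have hδ0 : 0 < δ := lt_of_lt_of_le (by positivity) hδ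
  have hσ0 : 0 ≤ σ := by simpa using A3 0 hkN
  have hpow : ∀ A, 0 ≤ A → ∀ j : ℕ, Real.sqrt (A * q ^ j) = Real.sqrt A * p ^ j := fun A hA j => by
    rw [Real.sqrt_mul hA]
    congr 1
    rw [Real.sqrt_eq_iff_mul_self_eq (by positivity) (by positivity), ← mul_pow,
      Real.mul_self_sqrt hq0.le]
  have hsq : ∀ A, 0 ≤ A → A ≤ 10 * K → ∀ i j, i + j ≤ k₁ →
      3 / l * (G * Real.sqrt (A * s * q ^ i)) * p ^ j ≤ 1 / 2 := fun A hA hAK i j hij => by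
    refine le_trans (le_of_eq ?_) (le_trans (mul_le_mul_of_nonneg_left
      (Real.sqrt_le_sqrt (x := A * s * q ^ i * q ^ j) ?_) (by positivity)) hGδ)
    · rw [hpow (A * s * q ^ i) (by positivity) j]; ring
    · calc A * s * q ^ i * q ^ j = A * (s * q ^ (i + j)) := by rw [pow_add]; ring
        _ ≤ 10 * K * (s * q ^ k₁) := by gcongr
        _ ≤ 10 * K * δ := by gcongr
  have hAρ : c * (C * s ^ 2 + L ^ 2 * c) / (l * c) = (C * s ^ 2 + L ^ 2 * c) / l := by field_simp
  have hE0 : 0 ≤ c * (C * s ^ 2 + L ^ 2 * c) := by positivity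
  have herr : ∀ f : ℕ → ℝ, (∀ k, |f k| ≤ c * (C * s ^ 2 + L ^ 2 * c)) → ∀ n,
      |∑ k ∈ Finset.range n, f k / q ^ (k + 1)| ≤ (C * s ^ 2 + L ^ 2 * c) / l := fun f hf n => by
    rw [← hAρ]
    exact abs_sum_div_pow_le hl hc n (fun k _ => hf k) hE0
  have hr' : ∀ n, |r n| ≤ c * (C * s ^ 2 + L ^ 2 * c) := fun n => by
    have : 0 ≤ c * (L ^ 2 * c) := by positivity
    linarith [hr n]
  -- the scheme stays close to the fixed point
  have B1 : ∀ n ≤ k₁, |x n - a| ≤ 4 * K * s * q ^ n := by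
    have := abs_le_of_linear_recursion hl hc hlc (κ := 2 * K * s) (H := G * Real.sqrt (4 * K * s))
      (v := fun n => x n - a) (g := fun n => b (x n) - l * (x n - a)) (e := fun n => r n + m n)
      (N := k₁) (by positivity) (by positivity) (fun n _ => by simp only [hx]; ring)
      (fun n hn => by
        simp only [hx0, sub_self, zero_add, add_div, Finset.sum_add_distrib]
        exact (abs_add_le _ _).trans (by linarith [A1 n hn, herr r hr' n]))
      (fun n _ hn => by
        have := hlin (x n) a
        rw [ha, sub_self a, abs_zero, max_eq_left (abs_nonneg _), sub_zero] at this
        rw [mul_assoc G, ← hpow _ (by positivity)]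
        refine this.trans ?_
        gcongr
        linarith)
      (by simpa using hsq (4 * K) (by positivity) (by linarith) 0 k₁ (by simp))
    exact fun n hn => (this n hn).trans (le_of_eq (by ring))
  set f : ℕ → ℝ := fun j => y (c * (j + 1 : ℕ)) - y (c * j) - c * b (y (c * j)) with hf
  have hf' : ∀ j, |f j| ≤ c * (L ^ 2 * c) := fun j => by
    have := hy.abs_euler_le hL hb hlip (s := c * j) (by positivity) hc.le
    rw [show c * (j : ℝ) + c = c * (j + 1 : ℕ) by push_cast; ring] at this
    exact this.trans (le_of_eq (by ring))
  have hf'' : ∀ j, |f j| ≤ c * (C * s ^ 2 + L ^ 2 * c) := fun j => by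
    have : 0 ≤ c * (C * s ^ 2) := by positivity
    linarith [hf' j]
  have hys : ∀ j : ℕ, y (c * (j + 1 : ℕ)) = y (c * j) + c * b (y (c * j)) + f j := fun j => by
    simp only [hf]; ring
  have hy0 : y (c * (0 : ℕ)) = x k₀ := by simpa using hy.1
  have hqk0 : 1 ≤ q ^ k₀ := one_le_pow₀ hq1
  have B2 : ∀ j ≤ k₁ - k₀, |y (c * j) - a| ≤ 10 * K * s * q ^ k₀ * q ^ j := by
    have := abs_le_of_linear_recursion hl hc hlc (κ := 5 * K * s * q ^ k₀)
      (H := G * Real.sqrt (10 * K * s * q ^ k₀))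
      (v := fun j => y (c * j) - a) (g := fun j => b (y (c * j)) - l * (y (c * j) - a)) (e := f)
      (N := k₁ - k₀) (by positivity) (by positivity) (fun n _ => by simp only [hys]; ring)
      (fun n hn => by
        simp only [hy0]
        have h1 : K * s ≤ K * s * q ^ k₀ := le_mul_of_one_le_right (by positivity) hqk0
        exact (abs_add_le _ _).trans (by linarith [B1 k₀ hk, herr f hf'' n]))
      (fun n _ hn => by
        have := hlin (y (c * n)) a
        rw [ha, sub_self a, abs_zero, max_eq_left (abs_nonneg _), sub_zero] at this
        rw [mul_assoc G, ← hpow _ (by positivity)]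
        refine this.trans ?_
        gcongr
        linarith)
      (hsq (10 * K) (by positivity) le_rfl k₀ (k₁ - k₀) (by omega))
    exact fun n hn => (this n hn).trans (le_of_eq (by ring))
  have hd : ∀ j, |r (k₀ + j) - f j| ≤ c * (C * s ^ 2 + L ^ 2 * c) := fun j => by
    have := abs_sub (r (k₀ + j)) (f j)
    linarith [hr (k₀ + j), hf' j]
  have B3 : ∀ j ≤ k₁ - k₀, |x (k₀ + j) - y (c * j)| ≤ 4 * κ * δ := by
    have := abs_le_of_linear_recursion hl hc hlc (κ := 2 * κ * s * q ^ k₀)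
      (H := G * Real.sqrt (10 * K * s * q ^ k₀))
      (v := fun j => x (k₀ + j) - y (c * j))
      (g := fun j => b (x (k₀ + j)) - b (y (c * j)) - l * (x (k₀ + j) - y (c * j)))
      (e := fun j => (r (k₀ + j) - f j) + m (k₀ + j))
      (N := k₁ - k₀) (by positivity) (by positivity)
      (fun n _ => by simp only [hys, ← add_assoc, hx]; ring)
      (fun n hn => by
        simp only [hy0, add_zero, sub_self, zero_add, add_div, Finset.sum_add_distrib]
        have h1 : κ * s ≤ κ * s * q ^ k₀ := le_mul_of_one_le_right (by positivity) hqk0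
        have h2 : ∑ i ∈ Finset.range n, m (k₀ + i) / q ^ (i + 1)
            = q ^ k₀ * ∑ i ∈ Finset.range n, m (k₀ + i) / q ^ (k₀ + i + 1) := by
          rw [Finset.mul_sum]
          refine Finset.sum_congr rfl fun i _ => ?_
          rw [add_assoc, pow_add q k₀ (i + 1)]
          field_simp
        have h3 : |q ^ k₀ * ∑ i ∈ Finset.range n, m (k₀ + i) / q ^ (k₀ + i + 1)|
            ≤ q ^ k₀ * (κ * s) := by
          rw [abs_mul, abs_of_pos (pow_pos hq0 _)]
          gcongr
          exact A2 n (by omega)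
        rw [h2]
        exact (abs_add_le _ _).trans (by linarith [herr _ hd n]))
      (fun n hn hvn => by
        refine (hlin _ _).trans ?_
        rw [mul_assoc G (Real.sqrt (10 * K * s * q ^ k₀)), ← hpow _ (by positivity)]
        gcongr
        refine max_le ((B1 (k₀ + n) (by omega)).trans ?_) (B2 n hn.le)
        rw [pow_add, ← mul_assoc]
        gcongr
        norm_num)
      (hsq (10 * K) (by positivity) le_rfl k₀ (k₁ - k₀) (by omega))
    intro j hj
    calc _ ≤ _ := this j hj
      _ = 4 * κ * (s * q ^ (k₀ + j)) := by rw [pow_add]; ring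
      _ ≤ 4 * κ * (s * q ^ k₁) := by
        gcongr
        omega
      _ ≤ _ := by gcongr
  have hτ0 : 0 ≤ τ := by
    refine le_trans (mul_nonneg hc.le ?_) hτ
    rw [sub_nonneg]; exact_mod_cast hkN
  have hrate : 0 ≤ τ * (C * s ^ 2 + L ^ 2 * c) := by positivity
  have hexp1 : 1 ≤ Real.exp (L * τ) := Real.one_le_exp (by positivity)
  have hNτ : ∀ n : ℕ, n ≤ N - k₁ → c * n ≤ τ := fun n hn => by
    refine le_trans ?_ hτ
    gcongr
    rw [le_sub_iff_add_le]
    exact_mod_cast (by omega : n + k₁ ≤ N)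
  have B4 : ∀ i ≤ N - k₁, |x (k₁ + i) - y (c * (k₁ - k₀ + i : ℕ))| ≤
      (4 * κ * δ + σ + τ * (C * s ^ 2 + L ^ 2 * c)) * Real.exp (L * τ) := by
    have hidx : ∀ i, k₀ + (k₁ - k₀ + i) = k₁ + i := fun i => by omega
    have := abs_le_of_lipschitz_recursion hc.le hL.le (σ := σ + τ * (C * s ^ 2 + L ^ 2 * c))
      (v := fun i => x (k₁ + i) - y (c * (k₁ - k₀ + i : ℕ)))
      (g := fun i => b (x (k₁ + i)) - b (y (c * (k₁ - k₀ + i : ℕ))))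
      (e := fun i => (r (k₁ + i) - f (k₁ - k₀ + i)) + m (k₁ + i)) (N := N - k₁)
      (fun n _ => by simp only [← add_assoc, hx, hys]; ring) (fun n _ => hlip _ _)
      (fun n hn => by
        rw [Finset.sum_add_distrib]
        have h1 : |∑ i ∈ Finset.range n, (r (k₁ + i) - f (k₁ - k₀ + i))|
            ≤ τ * (C * s ^ 2 + L ^ 2 * c) := by
          calc _ ≤ ∑ i ∈ Finset.range n, c * (C * s ^ 2 + L ^ 2 * c) := by
                refine (Finset.abs_sum_le_sum_abs _ _).trans (Finset.sum_le_sum fun i _ => ?_)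
                rw [← hidx i]; exact hd _
            _ = c * n * (C * s ^ 2 + L ^ 2 * c) := by
                rw [Finset.sum_const, Finset.card_range, nsmul_eq_mul]; ring
            _ ≤ _ := by gcongr; exact hNτ n hn
        exact (abs_add_le _ _).trans (by linarith [A3 n (by omega)]))
    intro i hi
    refine (this i hi).trans ?_
    have h0 := B3 (k₁ - k₀) le_rfl
    rw [show k₀ + (k₁ - k₀) = k₁ by omega] at h0
    simp only [add_zero]
    rw [add_assoc (4 * κ * δ)]
    gcongr
    exact hNτ i hi
  intro j hj
  rcases le_total (k₀ + j) k₁ with h | h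
  · refine (B3 j (by omega)).trans ?_
    have : 4 * κ * δ ≤ 4 * κ * δ + σ + τ * (C * s ^ 2 + L ^ 2 * c) := by linarith
    exact this.trans (le_mul_of_one_le_right (by positivity) hexp1)
  · have := B4 (k₀ + j - k₁) (by omega)
    rwa [show k₁ + (k₀ + j - k₁) = k₀ + j by omega, show k₁ - k₀ + (k₀ + j - k₁) = j by omega]
      at this

theorem weightedSum_cutoff {Ω : Type*} (k : ℕ) (w : ℕ → ℝ) (φ : ℝ → ℝ → ℝ) (Y ξ : ℕ → Ω → ℝ)
    (j : ℕ) (ω : Ω) :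
    weightedSum (fun i => if i < k then 0 else w i) φ Y ξ (k + j) ω
      = ∑ i ∈ Finset.range j, w (k + i) * φ (Y (k + i) ω) (ξ (k + i + 1) ω) := by
  rw [weightedSum, Finset.sum_range_add, Finset.sum_eq_zero, zero_add]
  · exact Finset.sum_congr rfl fun i _ => by simp
  · exact fun i hi => by simp [Finset.mem_range.1 hi]

theorem sum_cutoff_sq (k : ℕ) (w : ℕ → ℝ) (j : ℕ) :
    ∑ i ∈ Finset.range (k + j), (if i < k then 0 else w i) ^ 2
      = ∑ i ∈ Finset.range j, w (k + i) ^ 2 := by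
  rw [Finset.sum_range_add, Finset.sum_eq_zero, zero_add]
  · exact Finset.sum_congr rfl fun i _ => by simp
  · exact fun i hi => by simp [Finset.mem_range.1 hi]

/-- The mean displacement of a point by one particle. -/
noncomputable def meanDisp (h : ℝ → ℝ) (c x : ℝ) : ℝ := ∫ t, disp c (x - t) ∂angleLaw h

/-- The centred displacement of the point `x` by a particle attached at `t`. -/
noncomputable def noise (h : ℝ → ℝ) (c x t : ℝ) : ℝ := disp c (x - t) - meanDisp h c x

theorem X_succ (h : ℝ → ℝ) (c : ℝ) (θ : ℕ → ℝ) (x : ℝ) (n : ℕ) :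
    X c θ x (n + 1) = X c θ x n + c * drift h (X c θ x n)
      + (meanDisp h c (X c θ x n) - c * drift h (X c θ x n))
      + noise h c (X c θ x n) (θ (n + 1)) := by
  simp only [X, noise, disp]; ring

theorem measurable_gamma (c : ℝ) : Measurable (gamma c) := by
  have : gamma c = fun z => disp c z + z := by ext z; simp [disp]
  rw [this]
  exact (measurable_disp c).add measurable_id

theorem measurable_X {Ω : Type*} [MeasurableSpace Ω] {θ : ℕ → Ω → ℝ}
    (hθ : ∀ n, StronglyMeasurable (θ n)) (c x : ℝ) (n : ℕ) :
    Measurable[Filtration.natural θ hθ n] fun ω => X c (fun n => θ n ω) x n := by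
  induction n with
  | zero => exact @measurable_const _ _ _ (Filtration.natural θ hθ 0) x
  | succ n ih =>
    have h1 : Measurable[Filtration.natural θ hθ (n + 1)] fun ω => X c (fun n => θ n ω) x n :=
      ih.mono ((Filtration.natural θ hθ).mono n.le_succ) le_rfl
    have h2 : Measurable[Filtration.natural θ hθ (n + 1)] (θ (n + 1)) :=
      ((Filtration.stronglyAdapted_natural hθ) (n + 1)).measurable
    exact ((measurable_gamma c).comp (h1.sub h2)).add h2

section Noise

variable {h : ℝ → ℝ} [IsProbabilityMeasure (angleLaw h)] {c : ℝ}

theorem integrable_disp (hc : 0 ≤ c) (x : ℝ) :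
    Integrable (fun t => disp c (x - t)) (angleLaw h) :=
  Integrable.of_bound ((measurable_disp c).comp (by fun_prop)).aestronglyMeasurable (Real.sqrt c)
    (ae_of_all _ fun t => abs_disp_le hc (x - t))

theorem integrable_disp_sq (hc : 0 ≤ c) (x : ℝ) :
    Integrable (fun t => disp c (x - t) ^ 2) (angleLaw h) :=
  Integrable.of_bound
    (((measurable_disp c).comp (by fun_prop)).pow_const 2).aestronglyMeasurable (Real.sqrt c ^ 2)
    (ae_of_all _ fun t => by
      rw [Real.norm_eq_abs, abs_pow]
      exact pow_le_pow_left₀ (abs_nonneg _) (abs_disp_le hc (x - t)) 2)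

theorem measurable_noise : Measurable (Function.uncurry (noise h c)) := by
  have h1 : Measurable (Function.uncurry fun x t : ℝ => disp c (x - t)) :=
    (measurable_disp c).comp (by fun_prop : Measurable fun p : ℝ × ℝ => p.1 - p.2)
  have h2 : Measurable (meanDisp h c) :=
    (StronglyMeasurable.integral_prod_right h1.stronglyMeasurable).measurable
  exact h1.sub (h2.comp measurable_fst)

theorem abs_noise_le (hc : 0 ≤ c) (x t : ℝ) : |noise h c x t| ≤ 2 * Real.sqrt c := by
  have h1 : |meanDisp h c x| ≤ Real.sqrt c := by
    have := norm_integral_le_of_norm_le_const (μ := angleLaw h) (f := fun t => disp c (x - t))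
      (ae_of_all _ fun t => abs_disp_le hc (x - t))
    simpa [meanDisp] using this
  exact (abs_sub _ _).trans (by linarith [abs_disp_le hc (x - t)])

theorem integral_noise (hc : 0 ≤ c) (x : ℝ) : ∫ t, noise h c x t ∂angleLaw h = 0 := by
  simp only [noise]
  rw [integral_sub (integrable_disp hc x) (integrable_const _)]
  simp [meanDisp]

theorem integral_noise_sq_le (hc : 0 ≤ c) (x : ℝ) :
    ∫ t, noise h c x t ^ 2 ∂angleLaw h ≤ ∫ t, disp c (x - t) ^ 2 ∂angleLaw h := by
  have e : ∀ t, noise h c x t ^ 2 = disp c (x - t) ^ 2 - 2 * meanDisp h c x * disp c (x - t)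
      + meanDisp h c x ^ 2 := fun t => by simp only [noise]; ring
  simp only [e]
  have hi : Integrable (fun t => disp c (x - t) ^ 2 - 2 * meanDisp h c x * disp c (x - t))
      (angleLaw h) := (integrable_disp_sq hc x).sub ((integrable_disp hc x).const_mul _)
  rw [integral_add hi (integrable_const _), integral_sub (integrable_disp_sq hc x)
    ((integrable_disp hc x).const_mul _), integral_const_mul, ← meanDisp, integral_const,
    probReal_univ, one_smul]
  nlinarith [sq_nonneg (meanDisp h c x)]

end Noise

/-- Probability that the flow started at the fixed point `a` leaves the `ε`-neighbourhood of the
solution of the ODE which it meets at step `k₀`. -/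
theorem measure_exists_abs_sub_solution_le {Ω : Type*} [MeasurableSpace Ω] {P : Measure Ω}
    [IsProbabilityMeasure P] {h : ℝ → ℝ} {θ : ℕ → Ω → ℝ} (hθ : ∀ n, Measurable (θ n))
    (hind : iIndepFun θ P) (hlaw : ∀ n, P.map (θ n) = angleLaw h) {L G a l C : ℝ} (hL : 0 < L)
    (hb : ∀ x, |drift h x| ≤ L) (hlip : ∀ x y, |drift h x - drift h y| ≤ L * |x - y|)
    (hl : 0 < l) (hG : 0 < G) (ha : drift h a = 0)
    (hlin : ∀ x y, |drift h x - drift h y - l * (x - y)| ≤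
      G * Real.sqrt (max |x - a| |y - a|) * |x - y|) (hC : 0 < C)
    {c s K κ δ σ τ : ℝ} (hc : 0 < c) (hs : 0 < s) (hcs : Real.sqrt c = s ^ 2)
    (hmean : ∀ x, |(∫ t, disp c (x - t) ∂angleLaw h) - c * drift h x| ≤ C * (c * Real.sqrt c))
    (hvar : ∀ x, ∫ t, disp c (x - t) ^ 2 ∂angleLaw h ≤ C * (c * Real.sqrt c))
    (hlc : l * c ≤ 3) (hK : 0 < K) (hκ : 0 < κ) (hσ : 0 < σ)
    (hsmallK : (C * s ^ 2 + L ^ 2 * c) / l ≤ K * s) (hsmallκ : (C * s ^ 2 + L ^ 2 * c) / l ≤ κ * s)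
    {k₀ k₁ N : ℕ} (hk : k₀ ≤ k₁) (hkN : k₁ ≤ N)
    (hδ : s * (1 + l * c) ^ k₁ ≤ δ) (hGδ : 3 / l * G * Real.sqrt (10 * K * δ) ≤ 1 / 2)
    (hτ : c * ((N : ℝ) - k₁) ≤ τ) :
    P {ω | ∃ j, k₀ + j ≤ N ∧
      (4 * κ * δ + σ + τ * (C * s ^ 2 + L ^ 2 * c)) * Real.exp (L * τ) <
        |X c (fun n => θ n ω) a (k₀ + j)
          - psi (drift h) (c * j) (X c (fun n => θ n ω) a k₀)|} ≤
      ENNReal.ofReal (C / (l * K ^ 2)) + ENNReal.ofReal (C / (l * κ ^ 2 * ((1 + l * c) ^ k₀) ^ 2))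
        + ENNReal.ofReal (C * τ * s ^ 2 / σ ^ 2) := by
  have hprob : IsProbabilityMeasure (angleLaw h) := by
    rw [← hlaw 0]; exact Measure.isProbabilityMeasure_map (hθ 0).aemeasurable
  set q := 1 + l * c with hq
  have hq1 : 1 ≤ q := by linarith [mul_pos hl hc]
  have hq0 : 0 < q := by linarith
  set Y : ℕ → Ω → ℝ := fun n ω => X c (fun n => θ n ω) a n with hY
  set φ := noise h c with hφ
  have hmax : ∀ (w : ℕ → ℝ) {R : ℝ}, 0 < R → ∀ M : ℕ,
      P {ω | ∃ n ≤ M, R ≤ |weightedSum w φ Y θ n ω|} ≤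
        ENNReal.ofReal (C * (c * s ^ 2) * (∑ k ∈ Finset.range M, w k ^ 2) / R ^ 2) :=
    fun w R hR M => measure_exists_le_abs_weightedSum_le (fun n => (hθ n).stronglyMeasurable) hind
      hlaw (measurable_X _ c a) measurable_noise (abs_noise_le hc.le) (integral_noise hc.le)
      (fun x => (integral_noise_sq_le hc.le x).trans (by rw [← hcs]; exact hvar x)) w hR M
  set w : ℕ → ℝ := fun k => 1 / q ^ (k + 1) with hw
  have hwsum : ∀ M, ∑ k ∈ Finset.range M, w k ^ 2 ≤ 1 / (l * c) := fun M => by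
    refine (Finset.sum_le_sum fun k _ => ?_).trans (sum_inv_pow_le hl hc M)
    have h1 : 0 ≤ w k := by positivity
    have h2 : w k ≤ 1 := by
      rw [hw, div_le_one (by positivity)]; exact one_le_pow₀ hq1
    change w k ^ 2 ≤ w k
    nlinarith
  have hwshift : ∀ i, w (k₀ + i) = w i / q ^ k₀ := fun i => by
    simp only [hw]; rw [add_assoc, pow_add]; field_simp
  have e1 := hmax w (R := K * s) (by positivity) k₁
  have e2 := hmax (fun i => if i < k₀ then 0 else w i) (R := κ * s) (by positivity)
    (k₀ + (k₁ - k₀))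
  have e3 := hmax (fun i => if i < k₁ then 0 else 1) hσ (k₁ + (N - k₁))
  rw [sum_cutoff_sq k₀ w] at e2
  rw [sum_cutoff_sq k₁ fun _ => 1] at e3
  have f1 : C * (c * s ^ 2) * (∑ k ∈ Finset.range k₁, w k ^ 2) / (K * s) ^ 2
      ≤ C / (l * K ^ 2) := by
    calc _ ≤ C * (c * s ^ 2) * (1 / (l * c)) / (K * s) ^ 2 := by gcongr; exact hwsum k₁
      _ = _ := by field_simp
  have f2 : C * (c * s ^ 2) * (∑ i ∈ Finset.range (k₁ - k₀), w (k₀ + i) ^ 2) / (κ * s) ^ 2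
      ≤ C / (l * κ ^ 2 * (q ^ k₀) ^ 2) := by
    have : ∑ i ∈ Finset.range (k₁ - k₀), w (k₀ + i) ^ 2 ≤ 1 / (l * c) / (q ^ k₀) ^ 2 := by
      simp only [hwshift, div_pow]
      rw [← Finset.sum_div]
      gcongr
      exact hwsum _
    calc _ ≤ C * (c * s ^ 2) * (1 / (l * c) / (q ^ k₀) ^ 2) / (κ * s) ^ 2 := by gcongr
      _ = _ := by field_simp
  have f3 : C * (c * s ^ 2) * (∑ i ∈ Finset.range (N - k₁), (1 : ℝ) ^ 2) / σ ^ 2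
      ≤ C * τ * s ^ 2 / σ ^ 2 := by
    rw [one_pow, Finset.sum_const, Finset.card_range, nsmul_eq_mul, mul_one, Nat.cast_sub hkN]
    refine div_le_div_of_nonneg_right ?_ (by positivity)
    calc C * (c * s ^ 2) * ((N : ℝ) - k₁) = C * (c * ((N : ℝ) - k₁)) * s ^ 2 := by ring
      _ ≤ _ := by gcongr
  have g1 := e1.trans (ENNReal.ofReal_le_ofReal f1)
  have g2 := e2.trans (ENNReal.ofReal_le_ofReal f2)
  have g3 := e3.trans (ENNReal.ofReal_le_ofReal f3)
  refine le_trans (measure_mono ?_) ((measure_union_le _ _).trans (add_le_add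
    ((measure_union_le _ _).trans (add_le_add g1 g2)) g3))
  rintro ω ⟨j, hj, hlt⟩
  by_contra hω
  simp only [Set.mem_union, Set.mem_ofPred_eq, not_or, not_exists, not_and, not_le] at hω
  obtain ⟨⟨n1, n2⟩, n3⟩ := hω
  refine absurd hlt (not_lt.2 ?_)
  refine abs_sub_solution_le hL hb hlip hl hG ha hlin hc hs hlc hC hK hκ hsmallK hsmallκ
    (x := fun n => Y n ω) (r := fun n => meanDisp h c (Y n ω) - c * drift h (Y n ω))
    (m := fun n => φ (Y n ω) (θ (n + 1) ω)) rfl (fun n => X_succ h c _ a n)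
    (fun n => by rw [← hcs]; exact hmean _) hk hkN hδ hGδ hτ (fun n hn => ?_) (fun i hi => ?_)
    (fun i hi => ?_) (psi_isODESolution hL hb hlip _) j hj
  · have := (n1 n hn).le
    simpa only [weightedSum, hw, one_div_mul_eq_div] using this
  · have := (n2 (k₀ + i) (by omega)).le
    rw [weightedSum_cutoff] at this
    simpa only [hw, one_div_mul_eq_div] using this
  · have := (n3 (k₁ + i) (by omega)).le
    rw [weightedSum_cutoff k₁ fun _ => 1] at this
    simpa only [one_mul] using this

/-- A choice of a small positive real below a positive extended real. -/
theorem exists_pos_three_mul_ofReal_le {η : ENNReal} (hη : 0 < η) :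
    ∃ e : ℝ, 0 < e ∧ ENNReal.ofReal e + ENNReal.ofReal e + ENNReal.ofReal e ≤ η := by
  obtain ⟨r, hr0, hr⟩ := ENNReal.lt_iff_exists_nnreal_btwn.1 hη
  have hr0 : 0 < (r : ℝ) := by exact_mod_cast hr0
  refine ⟨r / 3, by positivity, le_trans (le_of_eq ?_) hr.le⟩
  rw [← ENNReal.ofReal_add (by positivity) (by positivity),
    ← ENNReal.ofReal_add (by positivity) (by positivity), ← ENNReal.ofReal_coe_nnreal]
  congr 1; ring

end AHL

set_option maxHeartbeats 1000000 in
theorem theorem5p1 {Ω : Type*} [MeasurableSpace Ω] (P : Measure Ω) [IsProbabilityMeasure P]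
    (h : ℝ → ℝ) (hh : AHL.IsSmoothDensity h)
    (θ : ℕ → Ω → ℝ) (hθ_meas : ∀ n, Measurable (θ n)) (hθ_indep : iIndepFun θ P)
    (hθ_law : ∀ n, P.map (θ n) = AHL.angleLaw h)
    (a_u lam_u : ℝ) (h_fixed : AHL.drift h a_u = 0)
    (h_deriv : HasDerivAt (AHL.drift h) lam_u a_u) (h_unstable : 0 < lam_u)
    (T : ℝ) (hT : 0 ≤ T) (ε : ℝ) (hε : 0 < ε) :
    Tendsto
      (fun t₀ : ℝ =>
        limsup
          (fun c : ℝ =>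
            P {ω | ENNReal.ofReal ε <
              ⨆ t ∈ Set.Icc t₀ (1 / (4 * lam_u) * Real.log (1 / c) + T),
                ENNReal.ofReal
                  |AHL.X c (fun n => θ n ω) a_u (AHL.numParticles c t) -
                    AHL.psi (AHL.drift h) (t - t₀)
                      (AHL.X c (fun n => θ n ω) a_u (AHL.numParticles c t₀))|})
          (𝓝[>] 0))
      atTop (𝓝 0) := by
  obtain ⟨L, hL, hb, hlip⟩ := hh.exists_drift_bound
  obtain ⟨G, hG, hlin⟩ := hh.exists_drift_linearization h_deriv
  obtain ⟨C, hC, hmom⟩ := hh.exists_moment_bound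
  set l := lam_u with hl_def
  have hl : 0 < l := h_unstable
  rw [ENNReal.tendsto_nhds_zero]
  intro η hη
  obtain ⟨e, he, heη⟩ := AHL.exists_pos_three_mul_ofReal_le hη
  set K := Real.sqrt (C / (l * e)) with hKdef
  have hK : 0 < K := Real.sqrt_pos.2 (by positivity)
  have hK2 : C / (l * K ^ 2) ≤ e := by
    rw [hKdef, Real.sq_sqrt (by positivity)]
    refine le_of_eq ?_
    field_simp
  set δ := (l / (6 * G)) ^ 2 / (10 * K) with hδdef
  have hδ : 0 < δ := by positivity
  have hGδ : 3 / l * G * Real.sqrt (10 * K * δ) ≤ 1 / 2 := by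
    rw [hδdef, mul_div_cancel₀ _ (by positivity), Real.sqrt_sq (by positivity)]
    refine le_of_eq ?_
    field_simp
    norm_num
  set S := |Real.log δ| / l with hSdef
  have hS : 0 ≤ S := by positivity
  have hSδ : Real.exp (-(l * S)) ≤ δ := by
    rw [hSdef, mul_div_cancel₀ _ hl.ne']
    calc Real.exp (-|Real.log δ|) ≤ Real.exp (Real.log δ) :=
          Real.exp_le_exp.2 (neg_abs_le _)
      _ = δ := Real.exp_log hδ
  set τ := T + S + 1 with hτdef
  have hτ : 0 < τ := by positivity
  set E := Real.exp (L * τ) with hEdef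
  have hE : 0 < E := Real.exp_pos _
  set κ := ε / (32 * δ * E) with hκdef
  have hκ : 0 < κ := by positivity
  set σ := ε / (8 * E) with hσdef
  have hσ : 0 < σ := by positivity
  have ht0 : ∀ᶠ t₀ : ℝ in atTop, C / (l * κ ^ 2 * (l * t₀) ^ 2) ≤ e := by
    have : Tendsto (fun t₀ : ℝ => C / (l * κ ^ 2 * (l * t₀) ^ 2)) atTop (𝓝 0) := by
      refine Tendsto.div_atTop tendsto_const_nhds ?_
      refine Tendsto.const_mul_atTop (by positivity) ?_
      exact (tendsto_pow_atTop two_ne_zero).comp (tendsto_id.const_mul_atTop hl)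
    exact (this.eventually (gt_mem_nhds he)).mono fun _ h => le_of_lt h
  filter_upwards [ht0, eventually_gt_atTop 0] with t₀ ht0e ht0
  refine limsup_le_of_le (h := ?_)
  have small : ∀ {f : ℝ → ℝ} {d : ℝ}, Continuous f → f 0 < d → ∀ᶠ c in 𝓝[>] (0 : ℝ), f c ≤ d :=
    fun hf h0 => nhdsWithin_le_nhds
      (((hf.tendsto 0).eventually_lt_const h0).mono fun _ h => le_of_lt h)
  set sf : ℝ → ℝ := fun c => Real.sqrt (Real.sqrt c) with hsf
  have hsfc : Continuous sf := by fun_prop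
  have hsf0 : sf 0 = 0 := by simp [hsf]
  have hlog : ∀ᶠ c in 𝓝[>] (0 : ℝ), t₀ + S ≤ 1 / (4 * l) * Real.log (1 / c) := by
    have : Tendsto (fun c : ℝ => 1 / (4 * l) * Real.log (1 / c)) (𝓝[>] 0) atTop := by
      refine Tendsto.const_mul_atTop (by positivity) (Real.tendsto_log_atTop.comp ?_)
      exact (tendsto_inv_nhdsGT_zero (𝕜 := ℝ)).congr fun c => (one_div c).symm
    exact this.eventually_ge_atTop _
  filter_upwards [self_mem_nhdsWithin, hlog,
    small (f := fun c => l * c) (d := 1) (by fun_prop) (by simp),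
    small (f := fun c => c) (d := 1) (by fun_prop) (by simp),
    small (f := fun c => L * c) (d := ε / 8) (by fun_prop) (by simpa using hε),
    small (f := fun c => (C * sf c + L ^ 2 * sf c ^ 3) / l) (d := K) (by fun_prop)
      (by simpa [hsf0] using hK),
    small (f := fun c => (C * sf c + L ^ 2 * sf c ^ 3) / l) (d := κ) (by fun_prop)
      (by simpa [hsf0] using hκ),
    small (f := fun c => τ * (C * sf c ^ 2 + L ^ 2 * c) * E) (d := ε / 8) (by fun_prop)
      (by simpa [hsf0] using hε),
    small (f := fun c => C * τ * sf c ^ 2 / σ ^ 2) (d := e) (by fun_prop)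
      (by simpa [hsf0] using he)] with c hc hlogc hlc hc1 hLc hsK hsκ hsτ hsσ
  have hc : 0 < c := hc
  set s := sf c with hs_def
  have hs : 0 < s := Real.sqrt_pos.2 (Real.sqrt_pos.2 hc)
  have hcs : Real.sqrt c = s ^ 2 := (Real.sq_sqrt (Real.sqrt_nonneg c)).symm
  have hc4 : c = s ^ 4 := by
    rw [show s ^ 4 = (s ^ 2) ^ 2 by ring, ← hcs, Real.sq_sqrt hc.le]
  have hlogs : Real.log s = Real.log c / 4 := by
    rw [hs_def, hsf, Real.log_sqrt (Real.sqrt_nonneg c), Real.log_sqrt hc.le]; ring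
  have hratio : ∀ {R : ℝ}, (C * s + L ^ 2 * s ^ 3) / l ≤ R →
      (C * s ^ 2 + L ^ 2 * c) / l ≤ R * s := fun {R} hR => by
    calc (C * s ^ 2 + L ^ 2 * c) / l = (C * s + L ^ 2 * s ^ 3) / l * s := by
          rw [hc4]; ring
      _ ≤ _ := by gcongr
  set Tc := 1 / (4 * l) * Real.log (1 / c) with hTc
  set k₀ := AHL.numParticles c t₀ with hk0
  set k₁ := AHL.numParticles c (Tc - S) with hk1
  set N := AHL.numParticles c (Tc + T) with hN
  have hmono : ∀ {t u : ℝ}, t ≤ u → AHL.numParticles c t ≤ AHL.numParticles c u := fun htu =>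
    Nat.floor_mono (by gcongr)
  have hfl : ∀ {t : ℝ}, 0 ≤ t → c * AHL.numParticles c t ≤ t ∧ t < c * AHL.numParticles c t + c :=
    fun {t} ht => by
      have h1 := Nat.floor_le (div_nonneg ht hc.le)
      have h2 := Nat.lt_floor_add_one (t / c)
      rw [le_div_iff₀ hc] at h1
      rw [div_lt_iff₀ hc] at h2
      constructor
      · rw [AHL.numParticles]; linarith
      · rw [AHL.numParticles]; linarith
  have hk : k₀ ≤ k₁ := hmono (by linarith)
  have hkN : k₁ ≤ N := hmono (by linarith)
  have hq0 : 0 < 1 + l * c := by positivity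
  have hgrow : s * (1 + l * c) ^ k₁ ≤ δ := by
    have h1 : (1 + l * c) ^ k₁ ≤ Real.exp (l * (Tc - S)) := by
      calc (1 + l * c) ^ k₁ ≤ Real.exp (l * c) ^ k₁ := by
            gcongr; linarith [Real.add_one_le_exp (l * c)]
        _ = Real.exp (l * (c * k₁)) := by rw [← Real.exp_nat_mul]; congr 1; ring
        _ ≤ _ := by
            gcongr
            exact (hfl (by linarith)).1
    have h2 : l * (Tc - S) = -Real.log s + -(l * S) := by
      rw [hTc, one_div c, Real.log_inv, hlogs]; field_simp; ring
    rw [h2, Real.exp_add, Real.exp_neg, Real.exp_log hs] at h1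
    calc s * (1 + l * c) ^ k₁ ≤ s * (s⁻¹ * Real.exp (-(l * S))) := by gcongr
      _ = Real.exp (-(l * S)) := by field_simp
      _ ≤ δ := hSδ
  have hτN : c * ((N : ℝ) - k₁) ≤ τ := by
    have h1 := (hfl (t := Tc + T) (by linarith)).1
    have h2 := (hfl (t := Tc - S) (by linarith)).2
    rw [mul_sub]
    linarith
  have hqk0 : l * t₀ ≤ (1 + l * c) ^ k₀ := by
    have h1 := one_add_mul_le_pow (show (-2 : ℝ) ≤ l * c by linarith [mul_pos hl hc]) k₀
    have h2 := (hfl ht0.le).2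
    have h3 : l * t₀ ≤ l * (c * k₀ + c) := by gcongr
    linarith
  refine le_trans (measure_mono ?_) ((AHL.measure_exists_abs_sub_solution_le hθ_meas hθ_indep
    hθ_law hL hb hlip hl hG h_fixed hlin hC hc hs hcs (fun x => (hmom c hc x).1)
    (fun x => (hmom c hc x).2) (by linarith) hK hκ hσ (hratio hsK) (hratio hsκ) hk hkN hgrow hGδ
    hτN).trans (le_trans ?_ heη))
  · intro ω hω
    simp only [Set.mem_ofPred_eq, lt_iSup_iff] at hω
    obtain ⟨t, ht, hlt⟩ := hω
    have hlt := (ENNReal.ofReal_lt_ofReal_iff_of_nonneg hε.le).1 hlt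
    have hn0 : k₀ ≤ AHL.numParticles c t := hmono ht.1
    have hnN : AHL.numParticles c t ≤ N := hmono ht.2
    obtain ⟨j, hj⟩ := Nat.exists_eq_add_of_le hn0
    refine ⟨j, hj ▸ hnN, ?_⟩
    rw [hj] at hlt
    have hodes := AHL.psi_isODESolution hL hb hlip (AHL.X c (fun n => θ n ω) a_u k₀)
    have hcj : |t - t₀ - c * j| ≤ c := by
      have h1 := hfl ht0.le
      have h2 := hfl (ht0.le.trans ht.1)
      rw [hj] at h2
      rw [Nat.cast_add, mul_add] at h2
      rw [abs_le]
      constructor <;> linarith [h1.1, h1.2, h2.1, h2.2]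
    have h3 := hodes.abs_sub_le hb (s := c * j) (t := t - t₀) (by positivity)
      (by linarith [ht.1])
    have h4 : L * |t - t₀ - c * j| ≤ L * c := by gcongr
    have h5 : (4 * κ * δ + σ + τ * (C * s ^ 2 + L ^ 2 * c)) * E ≤ ε / 8 + ε / 8 + ε / 8 := by
      have h6 : 4 * κ * δ * E = ε / 8 := by rw [hκdef]; field_simp; norm_num
      have h7 : σ * E = ε / 8 := by rw [hσdef]; field_simp
      rw [add_mul, add_mul, h6, h7]
      linarith
    have h8 := abs_sub_le (AHL.X c (fun n => θ n ω) a_u (k₀ + j))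
      (AHL.psi (AHL.drift h) (c * j) (AHL.X c (fun n => θ n ω) a_u k₀))
      (AHL.psi (AHL.drift h) (t - t₀) (AHL.X c (fun n => θ n ω) a_u k₀))
    rw [abs_sub_comm (AHL.psi (AHL.drift h) (c * j) _)] at h8
    linarith
  · gcongr
    · refine le_trans ?_ ht0e
      gcongr
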